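/- Let $M$ be a closed (compact, Hausdorff, without boundary) $C^\infty$ manifold and let $\varphi:\mathbb R\times M\to M$, $(t,x)\mapsto\varphi^t(x)$, be a $C^\infty$ flow whose vector field $X_x=\frac{d}{dt}\big|_{t=0}\varphi^t(x)$ vanishes nowhere. Call $\varphi$ parameter rigid if for every $C^\infty$ flow $\psi$ on $M$ that is locally free (all isotropy groups $\{t\in\mathbb R:\psi^t(x)=x\}$ are discrete) and has the same orbits as $\varphi$, there exist a $C^\infty$ diffeomorphism $F$ of $M$ mapping each orbit onto itself and a (continuous) automorphism $A$ of the group $\mathbb R$ such that $$F(\varphi^t(x))=\psi^{A(t)}(F(x))\qquad\text{for all }x\in M,\ t\in\mathbb R.$$ Then $\varphi$ is parameter rigid if and only if for every $f\in C^\infty(M)$ there exist $g\in C^\infty(M)$ and a constant $c\in\mathbb R$ such that $f=X(g)+c$ on $M$. -/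

import Mathlib

open scoped Manifold ContDiff

namespace ParamRigid

variable {n : ℕ} {M : Type*} [TopologicalSpace M] [ChartedSpace (EuclideanSpace ℝ (Fin n)) M]

/-- A flow (an action of `ℝ` on `M`) is smooth if the action map `ℝ × M → M` is `C^∞`. -/
def IsSmoothFlow (n : ℕ) {M : Type*} [TopologicalSpace M]
    [ChartedSpace (EuclideanSpace ℝ (Fin n)) M] (φ : Flow ℝ M) : Prop :=
  ContMDiff (𝓘(ℝ, ℝ).prod (𝓡 n)) (𝓡 n) ∞ (fun p : ℝ × M => φ p.1 p.2)

/-- An action of `ℝ` is locally free if every isotropy group `{t | φ t x = x}` is discrete,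
that is, `0` is an isolated point of it. -/
def IsLocallyFree {M : Type*} [TopologicalSpace M] (φ : Flow ℝ M) : Prop :=
  ∀ x : M, ∃ ε > 0, ∀ t : ℝ, 0 < |t| → |t| < ε → φ t x ≠ x

/-- `X` is the vector field of the flow `φ`: `X x = d/dt φ t x` at `t = 0`, for every `x`
(the base point is written `φ 0 x`, which equals `x`, so that the types agree). -/
def IsVectorFieldOf (φ : Flow ℝ M) (X : (x : M) → TangentSpace (𝓡 n) x) : Prop :=
  ∀ x : M, HasMFDerivAt 𝓘(ℝ, ℝ) (𝓡 n) (fun t : ℝ => φ t x) 0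
    ((1 : ℝ →L[ℝ] ℝ).smulRight (show TangentSpace (𝓡 n) (φ 0 x) from X (φ 0 x)))

/-- The derivative `X(g)` of the function `g` along the vector field `X`. -/
noncomputable def lieDeriv (X : (x : M) → TangentSpace (𝓡 n) x) (g : M → ℝ) (x : M) : ℝ :=
  mfderiv (𝓡 n) 𝓘(ℝ, ℝ) g x (X x)

/-- The two flows have the same orbit foliation: the leaf through each point is the same. -/
def SameOrbits {M : Type*} [TopologicalSpace M] (φ ψ : Flow ℝ M) : Prop :=
  ∀ x : M, φ.orbit x = ψ.orbit x

/-- A flow `φ` is parameter rigid if every smooth locally free flow `ψ` with the same orbit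
foliation is conjugate to `φ`, up to an automorphism `A` of the Lie group `ℝ`, by a
diffeomorphism `F` that maps each leaf of the foliation to itself. -/
def IsParameterRigid (n : ℕ) {M : Type*} [TopologicalSpace M]
    [ChartedSpace (EuclideanSpace ℝ (Fin n)) M] (φ : Flow ℝ M) : Prop :=
  ∀ ψ : Flow ℝ M, IsSmoothFlow n ψ → IsLocallyFree ψ → SameOrbits φ ψ →
    ∃ (F : M ≃ₘ^∞⟮𝓡 n, 𝓡 n⟯ M) (A : ℝ ≃ₜ+ ℝ),
      (∀ x : M, F '' φ.orbit x = φ.orbit x) ∧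
      ∀ (x : M) (t : ℝ), F (φ t x) = ψ (A t) (F x)

end ParamRigid

namespace ParamRigid

open Set Filter Topology MeasureTheory

/-! ### Smooth parameter integrals and the implicit function theorem on manifolds. -/

section Analysis

variable {E : Type*} [NormedAddCommGroup E] [NormedSpace ℝ E]

/-! Sufficiency. Let `ψ` be locally free with the orbits of `φ`, and let `Y` be its vector field. A
Baire argument along orbits shows that `X` and `Y` are parallel, so `X = f Y` with `f` smooth and
nowhere zero (`exists_contMDiff_smul_eq`). Write `f = X g + c`; at a maximum of `g` this gives `c ≠
0`. Integration gives `φ t x = ψ (g (φ t x) - g x + c t) x`, so `F x = ψ (-g x) x` conjugates `φ` to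
`ψ` with time multiplied by `c`.

Necessity. After adding a constant, `f > 0`. Let `ψ` be the time change with `φ t x = ψ (∫₀ᵗ f (φ s
x) ds) x`. Rigidity gives `F` and `c` with `F (φ t x) = ψ (c t) (F x)`. Since `F` preserves orbits,
`F x = ψ (v x) x` for some `v`, and on an aperiodic orbit `v (φ t x) + ∫₀ᵗ f = c t + v x`.
Differentiation yields `f = X(-v) + c`, once `v` is known to be smooth. If `φ` is minimal without
periodic points, Baire bounds `v` on an open set, the displacement equation spreads the local bound
to all of `M`, aperiodicity turns it into continuity, and the implicit function theorem gives
smoothness. If `φ` is minimal with a periodic point, `M` is one closed orbit and averaging over the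
period solves the equation.

The remaining point is that rigidity forces minimality (`IsParameterRigid.eq_univ_of_isMinimalSet`).
Let `K` be a minimal set. The time change by `1 + h`, with `h ≥ 0` vanishing exactly on `K`, has
`|c| = 1` because of the recurrent points in `K`; a recurrent point outside `K` would accumulate
unbounded delay, so there is none. If `p ∉ K`, its orbit is therefore non-recurrent in both
directions and accumulates on `K` at both ends. A bump near `p` delays this orbit by a fixed amount
and does not affect `K`. Among three bump sizes two have the same sign of `c`; comparing their
conjugacies at the two ends of the orbit of `p` produces too short a period for a point of `K`. -/

theorem contDiffOn_integral_unitInterval {s : Set E} (hs : IsOpen s) {F : E × ℝ → ℝ}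
    (hF : ContDiffOn ℝ ∞ F (s ×ˢ univ)) :
    ContDiffOn ℝ ∞ (fun y => ∫ u in (0 : ℝ)..1, F (y, u)) s := by
  obtain ⟨χ, hχ1, hχ⟩ : ∃ χ : ContDiffBump (0 : ℝ), (∀ u ∈ Icc (-1 : ℝ) 1, χ u = 1) ∧
      ∀ u ∉ Metric.closedBall (0 : ℝ) 2, χ u = 0 := by
    refine ⟨⟨1, 2, by norm_num, by norm_num⟩, fun u hu => ?_, fun u hu => ?_⟩
    · apply ContDiffBump.one_of_mem_closedBall
      simpa [abs_le] using hu
    · apply ContDiffBump.zero_of_le_dist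
      simp only [Metric.mem_closedBall, not_le] at hu
      exact hu.le
  -- The integral is the convolution of the indicator of `(0, 1]` with `g y`, evaluated at `0`;
  -- hence the sign in `-u`. The cutoff `χ` only provides compact support.
  let g : E → ℝ → ℝ := fun y u => χ u * F (y, -u)
  have hg : ContDiffOn ℝ ((⊤ : ℕ∞) : WithTop ℕ∞) (Function.uncurry g) (s ×ˢ univ) := by
    have h1 : ContDiffOn ℝ ∞ (fun p : E × ℝ => F (p.1, -p.2)) (s ×ˢ univ) :=
      hF.comp (contDiff_fst.prodMk contDiff_snd.neg).contDiffOn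
        (fun p hp => ⟨hp.1, mem_univ _⟩)
    exact ((χ.contDiff.comp contDiff_snd).contDiffOn (s := s ×ˢ univ)).mul h1
  have hf : LocallyIntegrable (indicator (Ioc (0 : ℝ) 1) fun _ => (1 : ℝ)) volume :=
    (locallyIntegrable_const (1 : ℝ)).indicator measurableSet_Ioc
  have key := contDiffOn_convolution_right_with_param_comp (n := ⊤)
    (ContinuousLinearMap.mul ℝ ℝ) (v := fun _ : E => (0 : ℝ)) (μ := volume)
    contDiffOn_const hs (isCompact_closedBall (0 : ℝ) 2)
    (g := g) (fun p x _ hx => by simp [g, hχ x hx]) hf hg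
  refine key.congr fun y _ => ?_
  simp only [convolution_def, intervalIntegral.integral_of_le zero_le_one]
  rw [← integral_indicator measurableSet_Ioc]
  congr 1
  ext u
  by_cases hu : u ∈ Ioc (0 : ℝ) 1
  · have : χ (-u) = 1 := hχ1 _ ⟨by linarith [hu.2], by linarith [hu.1]⟩
    simp [g, hu, this]
  · simp [hu]

variable {H : Type*} [TopologicalSpace H] {I : ModelWithCorners ℝ E H} [I.Boundaryless]
  {N : Type*} [TopologicalSpace N] [ChartedSpace H N] [IsManifold I ∞ N]

theorem contMDiff_integral_unitInterval {F : N × ℝ → ℝ}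
    (hF : ContMDiff (I.prod 𝓘(ℝ, ℝ)) 𝓘(ℝ, ℝ) ∞ F) :
    ContMDiff I 𝓘(ℝ, ℝ) ∞ (fun x => ∫ u in (0 : ℝ)..1, F (x, u)) := by
  intro x₀
  set e := extChartAt I x₀
  have h1 : ContDiffOn ℝ ∞ (fun p : E × ℝ => F (e.symm p.1, p.2)) (e.target ×ˢ univ) := by
    rw [← contMDiffOn_iff_contDiffOn]
    have h2 : ContMDiffOn 𝓘(ℝ, E × ℝ) (I.prod 𝓘(ℝ, ℝ)) ∞
        (fun p : E × ℝ => (e.symm p.1, p.2)) (e.target ×ˢ univ) := by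
      refine ContMDiffOn.prodMk ?_ ?_
      · exact (contMDiffOn_extChartAt_symm x₀).comp
          (contDiff_fst.contMDiff.contMDiffOn) (fun p hp => hp.1)
      · exact contDiff_snd.contMDiff.contMDiffOn
    exact hF.comp_contMDiffOn h2
  have h3 := contDiffOn_integral_unitInterval (isOpen_extChartAt_target x₀) h1
  have h4 : ContDiffAt ℝ ∞ (fun y => ∫ u in (0 : ℝ)..1, F (e.symm y, u)) (e x₀) :=
    h3.contDiffAt ((isOpen_extChartAt_target x₀).mem_nhds (mem_extChartAt_target x₀))
  have h5 := h4.contMDiffAt.comp x₀ (contMDiffAt_extChartAt (I := I) (n := ∞) (x := x₀))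
  refine h5.congr_of_eventuallyEq ?_
  filter_upwards [extChartAt_source_mem_nhds (I := I) x₀] with x hx
  simp only [Function.comp_apply, e, (extChartAt I x₀).left_inv hx]

/-- Continuity keeps `(y, w y)` in the neighbourhood where the implicit function is the only
solution, so `w` agrees with it near `y₀`. -/
theorem contDiffAt_of_implicit [CompleteSpace E] {Φ : E × ℝ → ℝ} {w : E → ℝ} {y₀ : E} {d : ℝ}
    (hΦ : ContDiffAt ℝ ∞ Φ (y₀, w y₀)) (hd : HasDerivAt (fun t => Φ (y₀, t)) d (w y₀))
    (hd0 : d ≠ 0) (hw : ContinuousAt w y₀) (h : ∀ᶠ y in 𝓝 y₀, Φ (y, w y) = Φ (y₀, w y₀)) :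
    ContDiffAt ℝ ∞ w y₀ := by
  have hinv : (fderiv ℝ Φ (y₀, w y₀) ∘L .inr ℝ E ℝ).IsInvertible := by
    have hf := (hΦ.differentiableAt (by simp)).hasFDerivAt
    have h1 : HasDerivAt (fun t : ℝ => (y₀, t)) ((0 : E), (1 : ℝ)) (w y₀) :=
      (hasDerivAt_const _ _).prodMk (hasDerivAt_id _)
    have h2 := (HasFDerivAt.comp_hasDerivAt (w y₀) hf h1).unique hd
    refine ⟨ContinuousLinearEquiv.unitsEquivAut ℝ (Units.mk0 d hd0), ?_⟩
    ext
    simp [h2]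
  have h1 := hΦ.contDiffAt_implicitFunction (by simp) hinv
  have h2 := hΦ.eventually_apply_eq_iff_implicitFunction (by simp) hinv
  have h3 : Tendsto (fun y => (y, w y)) (𝓝 y₀) (𝓝 (y₀, w y₀)) :=
    continuousAt_id.prodMk hw
  refine h1.congr_of_eventuallyEq ?_
  filter_upwards [h, h3.eventually h2] with y hy1 hy2
  exact (hy2.1 hy1).symm

theorem contMDiffAt_of_implicit [CompleteSpace E] {Φ : N × ℝ → ℝ} {w r : N → ℝ} {x₀ : N} {d : ℝ}
    (hΦ : ContMDiffAt (I.prod 𝓘(ℝ, ℝ)) 𝓘(ℝ, ℝ) ∞ Φ (x₀, w x₀))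
    (hd : HasDerivAt (fun t => Φ (x₀, t)) d (w x₀)) (hd0 : d ≠ 0) (hw : ContinuousAt w x₀)
    (hr : ContMDiffAt I 𝓘(ℝ, ℝ) ∞ r x₀) (h : ∀ᶠ x in 𝓝 x₀, Φ (x, w x) = r x) :
    ContMDiffAt I 𝓘(ℝ, ℝ) ∞ w x₀ := by
  set e := extChartAt I x₀ with he
  have hex : e.symm (e x₀) = x₀ := extChartAt_to_inv x₀
  have hsymm : ContMDiffAt 𝓘(ℝ, E) I ∞ e.symm (e x₀) :=
    (contMDiffOn_extChartAt_symm x₀).contMDiffAt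
      ((isOpen_extChartAt_target x₀).mem_nhds (mem_extChartAt_target x₀))
  have hc : ContDiffAt ℝ ∞ (fun p : E × ℝ => Φ (e.symm p.1, p.2) - r (e.symm p.1))
      (e x₀, w x₀) := by
    rw [← contMDiffAt_iff_contDiffAt]
    have h1 : ContMDiffAt 𝓘(ℝ, E × ℝ) I ∞ (fun p : E × ℝ => e.symm p.1) (e x₀, w x₀) :=
      ContMDiffAt.comp (e x₀, w x₀) (f := fun p : E × ℝ => p.1) hsymm
        contDiff_fst.contMDiff.contMDiffAt
    have h2 : ContMDiffAt 𝓘(ℝ, E × ℝ) (I.prod 𝓘(ℝ, ℝ)) ∞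
        (fun p : E × ℝ => (e.symm p.1, p.2)) (e x₀, w x₀) :=
      h1.prodMk contDiff_snd.contMDiff.contMDiffAt
    refine ContMDiffAt.sub ?_ ?_
    · exact ContMDiffAt.comp (g := Φ) _ (by simpa [hex] using hΦ) h2
    · exact ContMDiffAt.comp (g := r) _ (by simpa [hex] using hr) h1
  have hw' : ContDiffAt ℝ ∞ (w ∘ e.symm) (e x₀) := by
    have hev : ∀ᶠ y in 𝓝 (e x₀), Φ (e.symm y, w (e.symm y)) = r (e.symm y) := by
      have := hsymm.continuousAt.tendsto
      rw [hex] at this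
      exact this.eventually h
    refine contDiffAt_of_implicit (Φ := fun p : E × ℝ => Φ (e.symm p.1, p.2) - r (e.symm p.1))
      (d := d) (by simpa [hex] using hc) ?_ hd0 ?_ ?_
    · simpa [hex] using hd.sub_const (r x₀)
    · exact ContinuousAt.comp (by simpa [hex] using hw) hsymm.continuousAt
    · filter_upwards [hev] with y hy
      simp [hy, hev.self_of_nhds]
  have h5 := hw'.contMDiffAt.comp x₀ (contMDiffAt_extChartAt (I := I) (n := ∞) (x := x₀))
  refine h5.congr_of_eventuallyEq ?_
  filter_upwards [extChartAt_source_mem_nhds (I := I) x₀] with x hx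
  simp only [Function.comp_apply, e, (extChartAt I x₀).left_inv hx]

end Analysis

/-! ### Differentiation along flows. -/

section FlowCalculus

variable {n : ℕ} {M : Type*} [TopologicalSpace M] [ChartedSpace (EuclideanSpace ℝ (Fin n)) M]
  {V : Type*} [NormedAddCommGroup V] [NormedSpace ℝ V]
  {φ ψ : Flow ℝ M} {X Y : (x : M) → TangentSpace (𝓡 n) x}

theorem IsSmoothFlow.contMDiff_apply (hφ : IsSmoothFlow n φ) (t : ℝ) :
    ContMDiff (𝓡 n) (𝓡 n) ∞ (φ t) :=
  ContMDiff.comp (g := fun p : ℝ × M => φ p.1 p.2) hφ (contMDiff_const.prodMk contMDiff_id)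

theorem IsSmoothFlow.contMDiff_curve (hφ : IsSmoothFlow n φ) (x : M) :
    ContMDiff 𝓘(ℝ, ℝ) (𝓡 n) ∞ (fun t => φ t x) :=
  ContMDiff.comp (g := fun p : ℝ × M => φ p.1 p.2) hφ (contMDiff_id.prodMk contMDiff_const)

theorem IsSmoothFlow.exists_isVectorFieldOf (hφ : IsSmoothFlow n φ) :
    ∃ X : (x : M) → TangentSpace (𝓡 n) x, IsVectorFieldOf φ X := by
  -- Values are taken in the model space, so that the base points `φ 0 x` and `x` can be exchanged
  -- by rewriting.
  let y : M → EuclideanSpace ℝ (Fin n) := fun x =>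
    mfderiv 𝓘(ℝ, ℝ) (𝓡 n) (fun t => φ t x) 0 (1 : ℝ)
  refine ⟨y, fun x => ?_⟩
  have h := ((hφ.contMDiff_curve x).mdifferentiableAt (x := 0) (by simp)).hasMFDerivAt
  have hy : y (φ 0 x) = y x := congrArg y (φ.map_zero_apply x)
  let L : ℝ →L[ℝ] EuclideanSpace ℝ (Fin n) := mfderiv 𝓘(ℝ, ℝ) (𝓡 n) (fun t => φ t x) 0
  have hL : (1 : ℝ →L[ℝ] ℝ).smulRight (y (φ 0 x)) = L := by
    ext1
    rw [hy]
    exact one_smul ℝ (y x)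
  exact (congrArg (fun A : ℝ →L[ℝ] EuclideanSpace ℝ (Fin n) =>
    HasMFDerivAt 𝓘(ℝ, ℝ) (𝓡 n) (fun t => φ t x) 0 A) hL).mpr h

theorem IsVectorFieldOf.hasDerivAt_comp (hX : IsVectorFieldOf φ X) {g : M → V} {x : M}
    (hg : MDifferentiableAt (𝓡 n) 𝓘(ℝ, V) g x) :
    HasDerivAt (fun t => g (φ t x)) (mfderiv (𝓡 n) 𝓘(ℝ, V) g x (X x) : V) 0 := by
  let d : M → V := fun z => mfderiv (𝓡 n) 𝓘(ℝ, V) g z (X z)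
  have hg' : MDifferentiableAt (𝓡 n) 𝓘(ℝ, V) g (φ 0 x) := by rwa [φ.map_zero_apply]
  let D : EuclideanSpace ℝ (Fin n) →L[ℝ] V := mfderiv (𝓡 n) 𝓘(ℝ, V) g (φ 0 x)
  let v : EuclideanSpace ℝ (Fin n) := X (φ 0 x)
  have h : HasFDerivAt (fun t => g (φ t x)) (D ∘L (1 : ℝ →L[ℝ] ℝ).smulRight v) 0 :=
    (HasMFDerivAt.comp (0 : ℝ) hg'.hasMFDerivAt (hX x)).hasFDerivAt
  have h2 := h.hasDerivAt
  have hd : d (φ 0 x) = d x := congrArg d (φ.map_zero_apply x)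
  have h3 : (D ∘L (1 : ℝ →L[ℝ] ℝ).smulRight v) 1 = d x := by
    rw [← hd]
    change D ((1 : ℝ) • v) = D v
    rw [one_smul]
  rw [h3] at h2
  exact h2

theorem IsVectorFieldOf.hasDerivAt_lieDeriv (hX : IsVectorFieldOf φ X) {g : M → ℝ}
    (hg : ContMDiff (𝓡 n) 𝓘(ℝ, ℝ) ∞ g) (x : M) (t : ℝ) :
    HasDerivAt (fun s => g (φ s x)) (lieDeriv X g (φ t x)) t := by
  have h := hX.hasDerivAt_comp (hg.mdifferentiableAt (x := φ t x) (by simp))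
  have h' : HasDerivAt (fun s => g (φ s (φ t x))) (lieDeriv X g (φ t x)) (t - t) := by
    rw [sub_self]; exact h
  have h2 := h'.comp_sub_const t t
  refine h2.congr_of_eventuallyEq (Eventually.of_forall fun s => ?_)
  simp [← φ.map_add]

/-- The derivative at `0` of `G` along the curve `h ↦ ψ (w h) (φ h y)`. -/
theorem hasDerivAt_comp_flows (hφ : IsSmoothFlow n φ) (hψ : IsSmoothFlow n ψ)
    (hX : IsVectorFieldOf φ X) (hY : IsVectorFieldOf ψ Y) {G : M → V}
    (hG : ContMDiff (𝓡 n) 𝓘(ℝ, V) ∞ G) (y : M) {w : ℝ → ℝ} {c : ℝ} (hw0 : w 0 = 0)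
    (hw : HasDerivAt w c 0) :
    HasDerivAt (fun h => G (ψ (w h) (φ h y)))
      (c • (mfderiv (𝓡 n) 𝓘(ℝ, V) G y (Y y) : V) + (mfderiv (𝓡 n) 𝓘(ℝ, V) G y (X y) : V)) 0 := by
  let Q : ℝ × ℝ → V := fun p => G (ψ p.1 (φ p.2 y))
  have hQ : ContDiff ℝ ∞ Q := by
    rw [← contMDiff_iff_contDiff]
    have h1 : ContMDiff 𝓘(ℝ, ℝ × ℝ) (𝓡 n) ∞ (fun p : ℝ × ℝ => φ p.2 y) :=
      (hφ.contMDiff_curve y).comp contDiff_snd.contMDiff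
    have h2 : ContMDiff 𝓘(ℝ, ℝ × ℝ) (𝓡 n) ∞ (fun p : ℝ × ℝ => ψ p.1 (φ p.2 y)) :=
      ContMDiff.comp (g := fun p : ℝ × M => ψ p.1 p.2) hψ (contDiff_fst.contMDiff.prodMk h1)
    exact hG.comp h2
  have hd := (hQ.differentiable (by simp) (0, 0)).hasFDerivAt
  have hG' := hG.mdifferentiableAt (x := y) (by simp)
  have e1 : fderiv ℝ Q (0, 0) (1, 0) = mfderiv (𝓡 n) 𝓘(ℝ, V) G y (Y y) := by
    have h1 : HasDerivAt (fun t : ℝ => (t, (0 : ℝ))) ((1 : ℝ), (0 : ℝ)) 0 :=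
      (hasDerivAt_id _).prodMk (hasDerivAt_const _ _)
    have h2 := hY.hasDerivAt_comp hG'
    have h3 := HasFDerivAt.comp_hasDerivAt (f := fun t : ℝ => (t, (0 : ℝ))) (0 : ℝ) hd h1
    refine h3.unique (h2.congr_of_eventuallyEq (Eventually.of_forall fun s => ?_))
    simp [Q]
  have e2 : fderiv ℝ Q (0, 0) (0, 1) = mfderiv (𝓡 n) 𝓘(ℝ, V) G y (X y) := by
    have h1 : HasDerivAt (fun t : ℝ => ((0 : ℝ), t)) ((0 : ℝ), (1 : ℝ)) 0 :=
      (hasDerivAt_const _ _).prodMk (hasDerivAt_id _)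
    have h2 := hX.hasDerivAt_comp hG'
    have h3 := HasFDerivAt.comp_hasDerivAt (f := fun t : ℝ => ((0 : ℝ), t)) (0 : ℝ) hd h1
    refine h3.unique (h2.congr_of_eventuallyEq (Eventually.of_forall fun s => ?_))
    simp [Q]
  have h1 : HasDerivAt (fun t : ℝ => (w t, t)) (c, (1 : ℝ)) 0 := hw.prodMk (hasDerivAt_id _)
  have hd' : HasFDerivAt Q (fderiv ℝ Q (0, 0)) (w 0, 0) := by rw [hw0]; exact hd
  have h3 := HasFDerivAt.comp_hasDerivAt (f := fun t : ℝ => (w t, t)) (0 : ℝ) hd' h1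
  have : ((c, 1) : ℝ × ℝ) = c • (1, 0) + (0, 1) := by simp
  rw [this, map_add, map_smul, e1, e2] at h3
  exact h3

/-- Smooth functions separate points. This lets identities between points of `M` be proved by
differentiating real functions, in place of uniqueness for differential equations. -/
theorem eq_of_forall_contMDiff [IsManifold (𝓡 n) ∞ M] [T2Space M] [CompactSpace M] {x y : M}
    (h : ∀ g : M → ℝ, ContMDiff (𝓡 n) 𝓘(ℝ, ℝ) ∞ g → g x = g y) : x = y := by
  obtain ⟨g, hg1, hg2, -⟩ := (isClosed_singleton (x := y)).isOpen_compl.exists_contMDiff_support_eq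
    (n := ⊤) (𝓡 n)
  by_contra hxy
  have hx : x ∈ g.support := by rw [hg1]; exact hxy
  have hy : y ∉ g.support := by rw [hg1]; simp
  exact hx ((h g hg2).trans (by simpa using hy))

theorem flow_eq_self_of_vectorField_eq_zero [IsManifold (𝓡 n) ∞ M] [T2Space M] [CompactSpace M]
    (hψ : IsSmoothFlow n ψ) (hY : IsVectorFieldOf ψ Y) {x : M} (h0 : Y x = 0) (t : ℝ) :
    ψ t x = x := by
  refine eq_of_forall_contMDiff (n := n) fun g hg => ?_
  have hd : ∀ t, HasDerivAt (fun s => g (ψ s x)) 0 t := fun t => by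
    have h := hY.hasDerivAt_comp (((hg.comp (hψ.contMDiff_apply t))).mdifferentiableAt
      (x := x) (by simp))
    rw [h0, _root_.map_zero] at h
    have h' : HasDerivAt (fun s => (g ∘ ψ t) (ψ s x)) 0 (t - t) := by
      rw [sub_self]; exact h
    have h2 := h'.comp_sub_const t t
    refine h2.congr_of_eventuallyEq (Eventually.of_forall fun s => ?_)
    simp [← ψ.map_add]
  have := is_const_of_deriv_eq_zero (fun t => (hd t).differentiableAt) (fun t => (hd t).deriv) t 0
  simpa using this

variable [IsManifold (𝓡 n) ∞ M]

/-- In the chart the vector field is the time derivative at `0` of `e (φ t z)`, which is jointly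
smooth in `z` and `t`. -/
theorem IsVectorFieldOf.contMDiffAt_chart (hφ : IsSmoothFlow n φ) (hX : IsVectorFieldOf φ X)
    (x₀ : M) :
    ContMDiffAt (𝓡 n) 𝓘(ℝ, EuclideanSpace ℝ (Fin n)) ∞
      (fun z => (mfderiv (𝓡 n) 𝓘(ℝ, EuclideanSpace ℝ (Fin n)) (extChartAt (𝓡 n) x₀) z (X z) :
        EuclideanSpace ℝ (Fin n))) x₀ := by
  set e := extChartAt (𝓡 n) x₀
  have h1 : ContMDiffAt ((𝓡 n).prod 𝓘(ℝ, ℝ)) 𝓘(ℝ, EuclideanSpace ℝ (Fin n)) ∞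
      (Function.uncurry fun (z : M) (t : ℝ) => e (φ t z)) (x₀, 0) := by
    have h2 : ContMDiff ((𝓡 n).prod 𝓘(ℝ, ℝ)) (𝓡 n) ∞ (fun p : M × ℝ => φ p.2 p.1) :=
      ContMDiff.comp (g := fun p : ℝ × M => φ p.1 p.2) hφ (contMDiff_snd.prodMk contMDiff_fst)
    refine ContMDiffAt.comp (g := e) (f := fun p : M × ℝ => φ p.2 p.1) _ ?_ h2.contMDiffAt
    simp only [φ.map_zero_apply]
    exact contMDiffAt_extChartAt
  have h2 := ContMDiffAt.mfderiv (m := ∞) (fun (z : M) (t : ℝ) => e (φ t z)) (fun _ => (0 : ℝ))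
    h1 contMDiffAt_const (by simp)
  have h2' : ContMDiffAt (𝓡 n) 𝓘(ℝ, ℝ →L[ℝ] EuclideanSpace ℝ (Fin n)) ∞
      (fun z => fderiv ℝ (fun t : ℝ => e (φ t z)) 0) x₀ := by
    have e1 : (fun z => (mfderiv 𝓘(ℝ, ℝ) (𝓡 n) (fun t : ℝ => e (φ t z)) 0 :
        ℝ →L[ℝ] EuclideanSpace ℝ (Fin n))) = fun z => fderiv ℝ (fun t : ℝ => e (φ t z)) 0 :=
      funext fun z => mfderiv_eq_fderiv
    have e2 := inTangentCoordinates_model_space (I := 𝓘(ℝ, ℝ)) (I' := 𝓡 n) (fun _ : M => (0 : ℝ))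
      (fun z => e (φ 0 z)) (fun z => fderiv ℝ (fun t : ℝ => e (φ t z)) 0) x₀
    rw [← e2, ← e1]
    exact h2
  have h3 := h2'.clm_apply (contMDiffAt_const (c := (1 : ℝ)))
  refine h3.congr_of_eventuallyEq ?_
  filter_upwards [extChartAt_source_mem_nhds (I := 𝓡 n) x₀] with z hz
  have h4 := hX.hasDerivAt_comp (mdifferentiableAt_extChartAt (I := 𝓡 n) (x := x₀) (y := z)
    (by simpa using hz))
  exact h4.deriv.symm

end FlowCalculus

/-! ### Flows with the same orbits have parallel vector fields. -/

section Tangency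

variable {E : Type*} [NormedAddCommGroup E] [NormedSpace ℝ E]

/-- If `β τ = α (σ τ)` along an ultrafilter of nonzero times `τ → 0` on which `σ → 0`, then the
velocity of `β` at `0` is a multiple of the (nonzero) velocity of `α` at `0`. -/
theorem exists_smul_eq_of_reparam {α β : ℝ → E} {u v : E} (hα : HasDerivAt α u 0)
    (hβ : HasDerivAt β v 0) (hu : u ≠ 0) {𝒰 : Ultrafilter ℝ} (h𝒰 : (𝒰 : Filter ℝ) ≤ 𝓝[≠] 0)
    {σ : ℝ → ℝ} (hσ : Tendsto σ 𝒰 (𝓝 0)) (h0 : α 0 = β 0)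
    (h : ∀ᶠ τ in 𝒰, α (σ τ) = β τ) : ∃ r : ℝ, v = r • u := by
  have h𝒰0 : (𝒰 : Filter ℝ) ≤ 𝓝 0 := h𝒰.trans nhdsWithin_le_nhds
  have hne : ∀ᶠ τ : ℝ in (𝒰 : Filter ℝ), τ ≠ 0 := h𝒰 self_mem_nhdsWithin
  -- Since `u ≠ 0`, `α s - α 0` is at least of the order of `s`; so `σ τ / τ` stays bounded and has
  -- a limit along the ultrafilter. That limit is the factor.
  have hbig : σ =O[𝒰] (fun τ => τ) := by
    have h1 : (fun s : ℝ => s) =O[𝓝 0] fun s => α s - α 0 := by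
      have h2 := (HasDerivAtFilter.isTheta_sub hα hu).isBigO_symm.comp_tendsto
        (tendsto_id.prodMk (tendsto_const_pure (b := (0 : ℝ))))
      simpa [Function.comp_def] using h2
    have h2 : (fun τ => β τ - β 0) =O[𝓝 0] fun τ : ℝ => τ := by
      simpa using hβ.hasFDerivAt.isBigO_sub
    have h3 : σ =O[𝒰] fun τ => α (σ τ) - α 0 := h1.comp_tendsto hσ
    refine h3.trans ((h2.mono h𝒰0).congr' ?_ EventuallyEq.rfl)
    filter_upwards [h] with τ hτ
    rw [hτ, h0]
  obtain ⟨C, hC⟩ := hbig.bound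
  have hq : ∀ᶠ τ in 𝒰, σ τ / τ ∈ Icc (-C) C := by
    filter_upwards [hC, hne] with τ h1 h2
    rw [mem_Icc, ← abs_le, abs_div, div_le_iff₀ (abs_pos.2 h2)]
    simpa using h1
  obtain ⟨r, -, hr⟩ := (isCompact_Icc (a := -C) (b := C)).ultrafilter_le_nhds
    (𝒰.map fun τ => σ τ / τ) (le_principal_iff.2 hq)
  have hr' : Tendsto (fun τ => σ τ / τ) 𝒰 (𝓝 r) := hr
  refine ⟨r, ?_⟩
  have hlim1 : Tendsto (fun τ => τ⁻¹ • (β τ - β 0)) 𝒰 (𝓝 v) := by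
    have := (hasDerivAt_iff_tendsto_slope.1 hβ).mono_left h𝒰
    simpa [slope_fun_def] using this
  have hlim2 : Tendsto (fun τ => (σ τ / τ) • u + τ⁻¹ • (α (σ τ) - α 0 - σ τ • u)) 𝒰
      (𝓝 (r • u + 0)) := by
    refine (hr'.smul_const u).add ?_
    have h1 : (fun s => α s - α 0 - s • u) =o[𝓝 0] fun s : ℝ => s := by
      simpa using hα.isLittleO
    have h2 := (h1.comp_tendsto hσ).trans_isBigO hbig
    exact h2.tendsto_inv_smul_nhds_zero
  rw [add_zero] at hlim2
  refine tendsto_nhds_unique hlim1 (hlim2.congr' ?_)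
  filter_upwards [h] with τ hτ
  rw [hτ, h0, smul_sub τ⁻¹ (β τ - β 0), smul_smul, div_eq_inv_mul]
  abel

variable {n : ℕ} {M : Type*} [TopologicalSpace M] [ChartedSpace (EuclideanSpace ℝ (Fin n)) M]
  [IsManifold (𝓡 n) ∞ M] {φ ψ : Flow ℝ M} {X Y : (x : M) → TangentSpace (𝓡 n) x}

/-- A nonzero tangent vector has nonzero image under the derivative of a chart. -/
theorem mfderiv_extChartAt_ne_zero {x₀ z : M} (hz : z ∈ (extChartAt (𝓡 n) x₀).source)
    {v : TangentSpace (𝓡 n) z} (hv : v ≠ 0) :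
    (mfderiv (𝓡 n) 𝓘(ℝ, EuclideanSpace ℝ (Fin n)) (extChartAt (𝓡 n) x₀) z v :
      EuclideanSpace ℝ (Fin n)) ≠ 0 := by
  have hinj := (isInvertible_mfderiv_extChartAt (I := 𝓡 n) hz).injective
  intro h
  exact hv (hinj (h.trans (_root_.map_zero _).symm))

variable [T2Space M]

/-- Near a time `t₁` where the `ψ`-orbit of `x₀` stays in a compact piece of a `φ`-orbit, the
velocities of the two flows are proportional. -/
theorem exists_smul_eq_of_mem_interior (hX : IsVectorFieldOf φ X) (hY : IsVectorFieldOf ψ Y)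
    (hX0 : ∀ x, X x ≠ 0) {x₀ z₀ : M} {k t₁ : ℝ}
    (ht : t₁ ∈ interior {t | ψ t x₀ ∈ (fun s => φ s x₀) '' Icc (-k) k})
    (hz : ψ t₁ x₀ ∈ (extChartAt (𝓡 n) z₀).source) :
    ∃ r : ℝ, (mfderiv (𝓡 n) 𝓘(ℝ, EuclideanSpace ℝ (Fin n)) (extChartAt (𝓡 n) z₀) (ψ t₁ x₀)
        (Y (ψ t₁ x₀)) : EuclideanSpace ℝ (Fin n)) =
      r • (mfderiv (𝓡 n) 𝓘(ℝ, EuclideanSpace ℝ (Fin n)) (extChartAt (𝓡 n) z₀) (ψ t₁ x₀)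
        (X (ψ t₁ x₀)) : EuclideanSpace ℝ (Fin n)) := by
  obtain ⟨s₁, -, hs₁⟩ := interior_subset ht
  set p := ψ t₁ x₀ with hp
  replace hs₁ : φ s₁ x₀ = p := hs₁
  have hmd := mdifferentiableAt_extChartAt (I := 𝓡 n) (x := z₀) (y := p) (by simpa using hz)
  have hnear : ∀ᶠ τ in 𝓝 (0 : ℝ), ∃ s ∈ Icc (-k - s₁) (k - s₁), φ s p = ψ τ p := by
    have hc : Tendsto (fun τ : ℝ => τ + t₁) (𝓝 0) (𝓝 t₁) := by
      have : Continuous fun τ : ℝ => τ + t₁ := by fun_prop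
      simpa using this.tendsto 0
    filter_upwards [hc.eventually (mem_interior_iff_mem_nhds.1 ht)] with τ hτ
    obtain ⟨s, hs, hs'⟩ := hτ
    refine ⟨s - s₁, ⟨by linarith [hs.1], by linarith [hs.2]⟩, ?_⟩
    calc φ (s - s₁) p = φ s x₀ := by rw [← hs₁, ← φ.map_add, sub_add_cancel]
      _ = ψ (τ + t₁) x₀ := hs'
      _ = ψ τ p := ψ.map_add _ _ _
  choose! s hsI hs using fun τ (h : ∃ s ∈ Icc (-k - s₁) (k - s₁), φ s p = ψ τ p) => h
  let 𝒰 : Ultrafilter ℝ := Ultrafilter.of (𝓝[≠] 0)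
  have h𝒰 : (𝒰 : Filter ℝ) ≤ 𝓝[≠] 0 := Ultrafilter.of_le _
  have h𝒰0 : (𝒰 : Filter ℝ) ≤ 𝓝 0 := h𝒰.trans nhdsWithin_le_nhds
  have hev : ∀ᶠ τ in (𝒰 : Filter ℝ), ∃ s ∈ Icc (-k - s₁) (k - s₁), φ s p = ψ τ p := h𝒰0 hnear
  have hmem : ∀ᶠ τ in (𝒰 : Filter ℝ), s τ ∈ Icc (-k - s₁) (k - s₁) := hev.mono hsI
  obtain ⟨s', -, hs'⟩ := (isCompact_Icc (a := -k - s₁) (b := k - s₁)).ultrafilter_le_nhds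
    (𝒰.map s) (le_principal_iff.2 hmem)
  have hs'' : Tendsto s 𝒰 (𝓝 s') := hs'
  -- The times `s τ` need not tend to `0` when the orbit is periodic. Their limit `s'` fixes `p`, so
  -- subtracting it gives an admissible reparametrization that does tend to `0`.
  have hfix : φ s' p = p := by
    have h1 : Tendsto (fun τ => φ (s τ) p) 𝒰 (𝓝 (φ s' p)) :=
      ((φ.continuous continuous_id continuous_const).tendsto s').comp hs''
    have h2 : Tendsto (fun τ => ψ τ p) 𝒰 (𝓝 p) := by
      have : Continuous fun τ => ψ τ p := ψ.continuous continuous_id continuous_const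
      have := this.tendsto 0
      rw [ψ.map_zero_apply] at this
      exact this.mono_left h𝒰0
    refine tendsto_nhds_unique h1 (h2.congr' ?_)
    filter_upwards [hev] with τ hτ using (hs τ hτ).symm
  refine exists_smul_eq_of_reparam (hX.hasDerivAt_comp hmd) (hY.hasDerivAt_comp hmd)
    (mfderiv_extChartAt_ne_zero hz (hX0 p)) h𝒰 (σ := fun τ => s τ - s') ?_ ?_ ?_
  · simpa using hs''.sub_const s'
  · simp
  · filter_upwards [hev] with τ hτ
    rw [← hs τ hτ]
    nth_rewrite 1 [← hfix]
    rw [← φ.map_add, sub_add_cancel]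

/-- Linear independence at `x₀` would persist nearby. The `ψ`-orbit is covered by countably many
compact arcs of the `φ`-orbit, so by Baire arbitrarily small times lie in the interior of the set of
times spent in one arc, where the velocities are parallel. -/
theorem exists_smul_eq_of_sameOrbits (hφ : IsSmoothFlow n φ) (hψ : IsSmoothFlow n ψ)
    (hX : IsVectorFieldOf φ X) (hY : IsVectorFieldOf ψ Y) (hX0 : ∀ x, X x ≠ 0)
    (horb : SameOrbits φ ψ) (x₀ : M) : ∃ r : ℝ, Y x₀ = r • X x₀ := by
  let Xc : M → EuclideanSpace ℝ (Fin n) := fun z =>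
    mfderiv (𝓡 n) 𝓘(ℝ, EuclideanSpace ℝ (Fin n)) (extChartAt (𝓡 n) x₀) z (X z)
  let Yc : M → EuclideanSpace ℝ (Fin n) := fun z =>
    mfderiv (𝓡 n) 𝓘(ℝ, EuclideanSpace ℝ (Fin n)) (extChartAt (𝓡 n) x₀) z (Y z)
  have hXc : ContinuousAt Xc x₀ := (hX.contMDiffAt_chart hφ x₀).continuousAt
  have hYc : ContinuousAt Yc x₀ := (hY.contMDiffAt_chart hψ x₀).continuousAt
  have hsrc : x₀ ∈ (extChartAt (𝓡 n) x₀).source := mem_extChartAt_source x₀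
  by_contra hcon
  have hXc0 : ∀ z ∈ (extChartAt (𝓡 n) x₀).source, Xc z ≠ 0 := fun z hz =>
    mfderiv_extChartAt_ne_zero hz (hX0 z)
  have hli : LinearIndependent ℝ ![Xc x₀, Yc x₀] := by
    rw [LinearIndependent.pair_iff' (hXc0 x₀ hsrc)]
    intro a ha
    apply hcon
    refine ⟨a, (isInvertible_mfderiv_extChartAt (I := 𝓡 n) hsrc).injective ?_⟩
    rw [map_smul]
    exact ha.symm
  have hev : ∀ᶠ z in 𝓝 x₀, LinearIndependent ℝ ![Xc z, Yc z] := by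
    have hc : ContinuousAt (fun z => ![Xc z, Yc z]) x₀ := by
      rw [continuousAt_pi]
      intro i
      fin_cases i
      · exact hXc
      · exact hYc
    exact hc.eventually (isOpen_setOfPred_linearIndependent.mem_nhds hli)
  have hcurve : Tendsto (fun t => ψ t x₀) (𝓝 0) (𝓝 x₀) := by
    have : Continuous fun t => ψ t x₀ := ψ.continuous continuous_id continuous_const
    simpa using this.tendsto 0
  have hgood := hcurve.eventually (hev.and (extChartAt_source_mem_nhds (I := 𝓡 n) x₀))
  let A : ℕ → Set ℝ := fun k => {t | ψ t x₀ ∈ (fun s => φ s x₀) '' Icc (-(k : ℝ)) k}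
  have hA : ∀ k, IsClosed (A k) := fun k =>
    (isCompact_Icc.image (φ.continuous continuous_id continuous_const)).isClosed.preimage
      (ψ.continuous continuous_id continuous_const)
  have hU : ⋃ k, A k = univ := by
    refine eq_univ_of_forall fun t => ?_
    have : ψ t x₀ ∈ φ.orbit x₀ := by rw [horb x₀]; exact ψ.mem_orbit x₀ t
    obtain ⟨s, hs⟩ := φ.mem_orbit_iff.1 this
    obtain ⟨k, hk⟩ := exists_nat_ge |s|
    exact mem_iUnion.2 ⟨k, s, abs_le.1 hk, hs⟩
  obtain ⟨t₁, ht₁, ht₁'⟩ := (dense_iUnion_interior_of_closed hA hU).inter_nhds_nonempty hgood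
  obtain ⟨k, hk⟩ := mem_iUnion.1 ht₁
  obtain ⟨r, hr⟩ := exists_smul_eq_of_mem_interior hX hY hX0 hk ht₁'.2
  have hlin : LinearIndependent ℝ ![Xc (ψ t₁ x₀), Yc (ψ t₁ x₀)] := ht₁'.1
  rw [LinearIndependent.pair_iff' (hXc0 _ ht₁'.2)] at hlin
  exact hlin r hr.symm

/-- The vector field of a flow is a smooth nonvanishing multiple of the vector field of a locally
free flow with the same orbits. -/
theorem exists_contMDiff_smul_eq [CompactSpace M] (hφ : IsSmoothFlow n φ) (hψ : IsSmoothFlow n ψ)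
    (hX : IsVectorFieldOf φ X) (hY : IsVectorFieldOf ψ Y) (hX0 : ∀ x, X x ≠ 0)
    (hfree : IsLocallyFree ψ) (horb : SameOrbits φ ψ) :
    ∃ f : M → ℝ, ContMDiff (𝓡 n) 𝓘(ℝ, ℝ) ∞ f ∧ (∀ x, f x ≠ 0) ∧ ∀ x, X x = f x • Y x := by
  have hY0 : ∀ x, Y x ≠ 0 := fun x h0 => by
    obtain ⟨ε, hε, h⟩ := hfree x
    exact h (ε / 2) (by positivity) (by rw [abs_of_pos (by positivity)]; linarith)
      (flow_eq_self_of_vectorField_eq_zero hψ hY h0 _)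
  choose h hh using exists_smul_eq_of_sameOrbits hφ hψ hX hY hX0 horb
  have hh0 : ∀ x, h x ≠ 0 := fun x h0 => hY0 x (by rw [hh x, h0, zero_smul])
  have hXY : ∀ x, X x = (h x)⁻¹ • Y x := fun x => by
    rw [hh x, smul_smul, inv_mul_cancel₀ (hh0 x), one_smul]
  refine ⟨fun x => (h x)⁻¹, fun x₀ => ?_, fun x => inv_ne_zero (hh0 x), hXY⟩
  let Xc : M → EuclideanSpace ℝ (Fin n) := fun z =>
    mfderiv (𝓡 n) 𝓘(ℝ, EuclideanSpace ℝ (Fin n)) (extChartAt (𝓡 n) x₀) z (X z)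
  let Yc : M → EuclideanSpace ℝ (Fin n) := fun z =>
    mfderiv (𝓡 n) 𝓘(ℝ, EuclideanSpace ℝ (Fin n)) (extChartAt (𝓡 n) x₀) z (Y z)
  have hXc : ContMDiffAt (𝓡 n) 𝓘(ℝ, EuclideanSpace ℝ (Fin n)) ∞ Xc x₀ :=
    hX.contMDiffAt_chart hφ x₀
  have hYc : ContMDiffAt (𝓡 n) 𝓘(ℝ, EuclideanSpace ℝ (Fin n)) ∞ Yc x₀ :=
    hY.contMDiffAt_chart hψ x₀
  have hsrc : x₀ ∈ (extChartAt (𝓡 n) x₀).source := mem_extChartAt_source x₀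
  -- In a chart the factor is `⟨X, Y⟩ / ⟨Y, Y⟩`, which is smooth because `Y` does not vanish.
  have hquot : ContDiffAt ℝ ∞ (fun p : EuclideanSpace ℝ (Fin n) × EuclideanSpace ℝ (Fin n) =>
      inner ℝ p.1 p.2 / inner ℝ p.2 p.2) (Xc x₀, Yc x₀) := by
    refine (contDiffAt_fst.inner ℝ contDiffAt_snd).div (contDiffAt_snd.inner ℝ contDiffAt_snd) ?_
    exact inner_self_ne_zero.2 (mfderiv_extChartAt_ne_zero hsrc (hY0 x₀))
  have hcomp := ContMDiffAt.comp x₀ hquot.contMDiffAt (hXc.prodMk_space hYc)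
  refine hcomp.congr_of_eventuallyEq ?_
  filter_upwards [extChartAt_source_mem_nhds (I := 𝓡 n) x₀] with z hz
  have h1 : Xc z = (h z)⁻¹ • Yc z := by
    simp only [Xc, Yc]
    rw [hXY z, map_smul]
    rfl
  have h2 : inner ℝ (Yc z) (Yc z) ≠ 0 :=
    inner_self_ne_zero.2 (mfderiv_extChartAt_ne_zero hz (hY0 z))
  simp only [Function.comp_apply, h1, inner_smul_left]
  simp only [conj_trivial]
  field_simp

end Tangency

/-! ### Solvability of the cohomological equation implies rigidity. -/

section Sufficiency

variable {n : ℕ} {M : Type*} [TopologicalSpace M] [ChartedSpace (EuclideanSpace ℝ (Fin n)) M]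
  [IsManifold (𝓡 n) ∞ M] [T2Space M] [CompactSpace M] {φ ψ : Flow ℝ M}
  {X Y : (x : M) → TangentSpace (𝓡 n) x}

/-- If `X = (X g + c) Y`, then `φ` is the time change of `ψ` by the cocycle
`g (φ t x) - g x + c t`. -/
theorem flow_eq_of_vectorField_eq (hφ : IsSmoothFlow n φ) (hψ : IsSmoothFlow n ψ)
    (hX : IsVectorFieldOf φ X) (hY : IsVectorFieldOf ψ Y) {g : M → ℝ} {c : ℝ}
    (hg : ContMDiff (𝓡 n) 𝓘(ℝ, ℝ) ∞ g) (hXY : ∀ x, X x = (lieDeriv X g x + c) • Y x)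
    (t : ℝ) (x : M) : φ t x = ψ (g (φ t x) - g x + c * t) x := by
  let u : ℝ → ℝ := fun t => g (φ t x) + c * t
  have hu : ∀ t, HasDerivAt u (lieDeriv X g (φ t x) + c) t := fun t => by
    have h := (hX.hasDerivAt_lieDeriv hg x t).add ((hasDerivAt_id t).const_mul c)
    rw [mul_one] at h
    exact h
  -- Undoing the expected time change should freeze the point: the velocity `X - (X g + c) Y`
  -- vanishes, so every smooth test function is constant along this curve.
  have key : ψ (-u t) (φ t x) = ψ (-u 0) (φ 0 x) := by
    refine eq_of_forall_contMDiff (n := n) fun G₀ hG₀ => ?_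
    have hd : ∀ t, HasDerivAt (fun s => G₀ (ψ (-u s) (φ s x))) 0 t := fun t => by
      have hw : HasDerivAt (fun h => -(u (t + h) - u t)) (-(lieDeriv X g (φ t x) + c)) 0 := by
        have h1 : HasDerivAt u (lieDeriv X g (φ t x) + c) (t + 0) := by
          rw [add_zero]; exact hu t
        exact ((h1.comp_const_add t 0).sub_const _).neg
      have hG := hG₀.comp (hψ.contMDiff_apply (-u t))
      have h := hasDerivAt_comp_flows hφ hψ hX hY hG (φ t x) (by simp) hw
      have h0 : (-(lieDeriv X g (φ t x) + c)) •
            (mfderiv (𝓡 n) 𝓘(ℝ, ℝ) (G₀ ∘ ψ (-u t)) (φ t x) (Y (φ t x)) : ℝ) +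
          (mfderiv (𝓡 n) 𝓘(ℝ, ℝ) (G₀ ∘ ψ (-u t)) (φ t x) (X (φ t x)) : ℝ) = 0 := by
        rw [hXY (φ t x), map_smul, neg_smul]
        exact neg_add_cancel _
      rw [h0] at h
      have h' : HasDerivAt (fun h => (G₀ ∘ ψ (-u t)) (ψ (-(u (t + h) - u t)) (φ h (φ t x)))) 0
          (t - t) := by
        rw [sub_self]; exact h
      refine (h'.comp_sub_const t t).congr_of_eventuallyEq (Eventually.of_forall fun s => ?_)
      simp only [Function.comp_apply, ← ψ.map_add, ← φ.map_add, sub_add_cancel, add_sub_cancel]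
      congr 2
      ring
    exact is_const_of_deriv_eq_zero (fun t => (hd t).differentiableAt) (fun t => (hd t).deriv) t 0
  have h2 := congrArg (ψ (u t)) key
  rw [← ψ.map_add, ← ψ.map_add, φ.map_zero_apply, add_neg_cancel, ψ.map_zero_apply] at h2
  have : u t + -u 0 = g (φ t x) - g x + c * t := by
    simp only [u, φ.map_zero_apply]
    ring
  rw [← this]
  exact h2

/-- The automorphism `t ↦ c t` of the topological group `ℝ`, for `c ≠ 0`. -/
noncomputable def mulLeftAut (c : ℝ) (hc : c ≠ 0) : ℝ ≃ₜ+ ℝ where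
  toFun t := c * t
  invFun t := c⁻¹ * t
  left_inv t := by field_simp
  right_inv t := by field_simp
  map_add' s t := mul_add c s t
  continuous_toFun := by fun_prop
  continuous_invFun := by fun_prop

theorem isParameterRigid_of_cohomologous (hφ : IsSmoothFlow n φ) (hX : IsVectorFieldOf φ X)
    (hX0 : ∀ x : M, X x ≠ 0)
    (hcoh : ∀ f : M → ℝ, ContMDiff (𝓡 n) 𝓘(ℝ, ℝ) ∞ f →
      ∃ (g : M → ℝ) (c : ℝ), ContMDiff (𝓡 n) 𝓘(ℝ, ℝ) ∞ g ∧ ∀ x : M, f x = lieDeriv X g x + c) :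
    IsParameterRigid n φ := by
  intro ψ hψ hfree horb
  rcases isEmpty_or_nonempty M with hM | hM
  · exact ⟨Diffeomorph.refl _ _ _, ContinuousAddEquiv.refl ℝ, fun x => hM.elim x,
      fun x => hM.elim x⟩
  obtain ⟨Y, hY⟩ := hψ.exists_isVectorFieldOf
  obtain ⟨f, hf, hf0, hXY⟩ := exists_contMDiff_smul_eq hφ hψ hX hY hX0 hfree horb
  obtain ⟨g, c, hg, hfg⟩ := hcoh f hf
  obtain ⟨x₁, -, hx₁⟩ := isCompact_univ.exists_isMaxOn univ_nonempty hg.continuous.continuousOn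
  -- At a maximum of `g` the derivative along `X` vanishes, so `c` equals the nonzero value of `f`
  -- there.
  have hc : c ≠ 0 := by
    have h1 : HasDerivAt (fun t => g (φ t x₁)) (lieDeriv X g x₁) 0 := by
      simpa using hX.hasDerivAt_lieDeriv hg x₁ 0
    have h2 : IsLocalMax (fun t => g (φ t x₁)) 0 :=
      Eventually.of_forall fun t => by simpa using hx₁ (mem_univ (φ t x₁))
    have h3 := hfg x₁
    rw [h2.hasDerivAt_eq_zero h1, zero_add] at h3
    rw [← h3]
    exact hf0 x₁
  have key := flow_eq_of_vectorField_eq hφ hψ hX hY hg (c := c)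
    (fun x => by rw [← hfg x]; exact hXY x)
  have hF : ∀ x t, ψ (-g (φ t x)) (φ t x) = ψ (c * t) (ψ (-g x) x) := fun x t => by
    nth_rewrite 2 [key t x]
    rw [← ψ.map_add, ← ψ.map_add]
    congr 1
    ring
  have hright : ∀ y, ψ (-g (φ (g y / c) y)) (φ (g y / c) y) = y := fun y => by
    rw [hF, ← ψ.map_add, mul_div_cancel₀ _ hc, add_neg_cancel, ψ.map_zero_apply]
  have hleft : ∀ x, φ (g (ψ (-g x) x) / c) (ψ (-g x) x) = x := fun x => by
    -- Since `g` is bounded and `c ≠ 0`, the intermediate value theorem gives `τ`; for it `F x = φ τ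
    -- x`, and the candidate inverse flows back by exactly `τ`.
    obtain ⟨τ, hτ⟩ : ∃ τ, g (φ τ x) + c * τ = 0 := by
      obtain ⟨B, hB⟩ := isCompact_univ.exists_bound_of_continuousOn
        (hg.continuous.continuousOn (s := univ))
      have hcont : Continuous fun τ => g (φ τ x) + c * τ :=
        (hg.continuous.comp (φ.continuous continuous_id continuous_const)).add (by fun_prop)
      have h1 : ∀ s, -B ≤ g (φ (s / c) x) ∧ g (φ (s / c) x) ≤ B := fun s =>
        abs_le.1 (hB (φ (s / c) x) (mem_univ _))
      have h2 : ∀ s, c * (s / c) = s := fun s => mul_div_cancel₀ s hc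
      exact mem_range_of_exists_le_of_exists_ge hcont
        ⟨-B / c, by rw [h2]; linarith [(h1 (-B)).2]⟩ ⟨B / c, by rw [h2]; linarith [(h1 B).1]⟩
    have h3 : ψ (-g x) x = φ τ x := by
      rw [key τ x]
      congr 1
      linarith
    rw [h3, ← φ.map_add]
    have : g (φ τ x) / c + τ = 0 := by
      field_simp
      linarith
    rw [this, φ.map_zero_apply]
  let F : M ≃ₘ^∞⟮𝓡 n, 𝓡 n⟯ M :=
    { toFun := fun x => ψ (-g x) x
      invFun := fun y => φ (g y / c) y
      left_inv := hleft
      right_inv := hright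
      contMDiff_toFun := ContMDiff.comp (g := fun p : ℝ × M => ψ p.1 p.2) hψ
        (hg.neg.prodMk contMDiff_id)
      contMDiff_invFun := ContMDiff.comp (g := fun p : ℝ × M => φ p.1 p.2) hφ
        (ContMDiff.prodMk (by
          simp only [div_eq_mul_inv]
          exact hg.mul contMDiff_const) contMDiff_id) }
  have hconj : ∀ x t, F (φ t x) = ψ (c * t) (F x) := hF
  refine ⟨F, mulLeftAut c hc, fun x => ?_, hconj⟩
  apply Subset.antisymm
  · rintro _ ⟨_, ⟨t, rfl⟩, rfl⟩
    rw [horb x]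
    change F (φ t x) ∈ _
    rw [hconj]
    change ψ (c * t) (ψ (-g x) x) ∈ _
    rw [← ψ.map_add]
    exact ψ.mem_orbit x _
  · rintro _ ⟨t, rfl⟩
    refine ⟨F.symm (φ t x), ?_, F.apply_symm_apply _⟩
    change φ (g (φ t x) / c) (φ t x) ∈ _
    rw [← φ.map_add]
    exact φ.mem_orbit x _

end Sufficiency

/-- The integral of `f` along the piece of orbit `s ↦ φ s x`, `s` from `0` to `t`. -/
noncomputable def orbitIntegral {M : Type*} [TopologicalSpace M] (φ : Flow ℝ M) (f : M → ℝ)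
    (t : ℝ) (x : M) : ℝ :=
  ∫ s in (0 : ℝ)..t, f (φ s x)

/-! ### The integral cocycle along orbits. -/

section OrbitIntegral

variable {M : Type*} [TopologicalSpace M] {φ : Flow ℝ M} {f h : M → ℝ}

theorem continuous_comp_orbit (φ : Flow ℝ M) (hf : Continuous f) (x : M) :
    Continuous fun s => f (φ s x) :=
  hf.comp (φ.continuous continuous_id continuous_const)

@[simp]
theorem orbitIntegral_zero (x : M) : orbitIntegral φ f 0 x = 0 := by
  simp [orbitIntegral]

theorem orbitIntegral_add (hf : Continuous f) (s t : ℝ) (x : M) :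
    orbitIntegral φ f (s + t) x = orbitIntegral φ f t x + orbitIntegral φ f s (φ t x) := by
  have hi : ∀ a b, IntervalIntegrable (fun s => f (φ s x)) volume a b := fun a b =>
    (continuous_comp_orbit φ hf x).intervalIntegrable a b
  have h1 : orbitIntegral φ f s (φ t x) = ∫ r in t..(s + t), f (φ r x) := by
    have := intervalIntegral.integral_comp_add_right (a := 0) (b := s) (fun r => f (φ r x)) t
    rw [zero_add] at this
    rw [← this]
    simp only [orbitIntegral, φ.map_add]
  rw [h1]
  exact (intervalIntegral.integral_add_adjacent_intervals (hi 0 t) (hi t (s + t))).symm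

theorem hasDerivAt_orbitIntegral (hf : Continuous f) (t : ℝ) (x : M) :
    HasDerivAt (fun t => orbitIntegral φ f t x) (f (φ t x)) t :=
  intervalIntegral.integral_hasDerivAt_right
    ((continuous_comp_orbit φ hf x).intervalIntegrable _ _)
    (continuous_comp_orbit φ hf x).aestronglyMeasurable.stronglyMeasurableAtFilter
    (continuous_comp_orbit φ hf x).continuousAt

theorem continuous_orbitIntegral (hf : Continuous f) (x : M) :
    Continuous fun t => orbitIntegral φ f t x :=
  continuous_iff_continuousAt.2 fun t => (hasDerivAt_orbitIntegral hf t x).continuousAt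

theorem strictMono_orbitIntegral (hf : Continuous f) (hpos : ∀ x, 0 < f x) (x : M) :
    StrictMono fun t => orbitIntegral φ f t x :=
  strictMono_of_deriv_pos fun t => by
    rw [(hasDerivAt_orbitIntegral hf t x).deriv]
    exact hpos _

theorem monotone_orbitIntegral (hf : Continuous f) (hpos : ∀ x, 0 ≤ f x) (x : M) :
    Monotone fun t => orbitIntegral φ f t x :=
  monotone_of_deriv_nonneg (fun t => (hasDerivAt_orbitIntegral hf t x).differentiableAt)
    fun t => by
      rw [(hasDerivAt_orbitIntegral hf t x).deriv]
      exact hpos _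

theorem orbitIntegral_one_add (hh : Continuous h) (l t : ℝ) (x : M) :
    orbitIntegral φ (fun y => 1 + l * h y) t x = t + l * orbitIntegral φ h t x := by
  have hi := (continuous_comp_orbit φ hh x).intervalIntegrable (μ := volume) 0 t
  simp only [orbitIntegral]
  rw [intervalIntegral.integral_add (by simp) (hi.const_mul l)]
  simp

theorem orbitIntegral_reverse (t : ℝ) (x : M) :
    orbitIntegral φ.reverse f t x = -orbitIntegral φ f (-t) x := by
  simp only [orbitIntegral, Flow.reverse_apply]
  rw [intervalIntegral.integral_comp_neg (fun s => f (φ s x)), neg_zero,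
    intervalIntegral.integral_symm]

theorem surjective_orbitIntegral [CompactSpace M] (hf : Continuous f) (hpos : ∀ x, 0 < f x)
    (x : M) : Function.Surjective fun t => orbitIntegral φ f t x := by
  obtain ⟨x₁, -, hx₁⟩ := isCompact_univ.exists_isMinOn ⟨x, mem_univ x⟩ hf.continuousOn
  set m := f x₁
  have hm : 0 < m := hpos x₁
  -- The minimum `m > 0` of `f` forces at least linear growth in both time directions.
  have hmono : Monotone fun t => orbitIntegral φ f t x - m * t := by
    have hd : ∀ t, HasDerivAt (fun t => orbitIntegral φ f t x - m * t) (f (φ t x) - m * 1) t :=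
      fun t => (hasDerivAt_orbitIntegral hf t x).sub ((hasDerivAt_id t).const_mul m)
    refine monotone_of_deriv_nonneg (fun t => (hd t).differentiableAt) fun t => ?_
    rw [(hd t).deriv, mul_one]
    exact sub_nonneg.2 (hx₁ (mem_univ _))
  have hcont := continuous_orbitIntegral (φ := φ) hf x
  refine hcont.surjective ?_ ?_
  · refine tendsto_atTop_mono' _ ?_ (tendsto_id.const_mul_atTop hm)
    filter_upwards [eventually_ge_atTop 0] with t ht
    have := hmono ht
    simp at this
    simpa using this
  · refine tendsto_atBot_mono' _ ?_ (tendsto_id.const_mul_atBot hm)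
    filter_upwards [eventually_le_atBot 0] with t ht
    have := hmono ht
    simp at this
    simpa using this

variable {n : ℕ} [ChartedSpace (EuclideanSpace ℝ (Fin n)) M] [IsManifold (𝓡 n) ∞ M]

/-- Substituting `s = u t` moves the variable endpoint into the integrand and leaves an integral
over the unit interval. -/
theorem contMDiff_orbitIntegral (hφ : IsSmoothFlow n φ) (hf : ContMDiff (𝓡 n) 𝓘(ℝ, ℝ) ∞ f) :
    ContMDiff (𝓘(ℝ, ℝ).prod (𝓡 n)) 𝓘(ℝ, ℝ) ∞ (fun p : ℝ × M => orbitIntegral φ f p.1 p.2) := by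
  have h1 : ContMDiff ((𝓘(ℝ, ℝ).prod (𝓡 n)).prod 𝓘(ℝ, ℝ)) 𝓘(ℝ, ℝ) ∞
      (fun q : (ℝ × M) × ℝ => f (φ (q.2 * q.1.1) q.1.2)) := by
    refine hf.comp (ContMDiff.comp (g := fun p : ℝ × M => φ p.1 p.2)
      (f := fun q : (ℝ × M) × ℝ => (q.2 * q.1.1, q.1.2)) hφ ?_)
    exact (contMDiff_snd.mul (contMDiff_fst.comp contMDiff_fst)).prodMk
      (contMDiff_snd.comp contMDiff_fst)
  have h2 := contMDiff_fst.mul (contMDiff_integral_unitInterval h1)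
  refine h2.congr fun p => ?_
  have := intervalIntegral.smul_integral_comp_mul_right (a := 0) (b := 1)
    (fun s => f (φ s p.2)) p.1
  rw [zero_mul, one_mul] at this
  exact this.symm

end OrbitIntegral

/-! ### Time changes of a flow. -/

section TimeChange

variable {n : ℕ} {M : Type*} [TopologicalSpace M] [ChartedSpace (EuclideanSpace ℝ (Fin n)) M]
  [IsManifold (𝓡 n) ∞ M] {φ : Flow ℝ M} {X : (x : M) → TangentSpace (𝓡 n) x} {f : M → ℝ}

/-- In a chart the orbit has nonzero velocity at time `0`, so it cannot return to `x` at arbitrarily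
small nonzero times. -/
theorem isLocallyFree_of_vectorField_ne_zero (hX : IsVectorFieldOf φ X) (hX0 : ∀ x, X x ≠ 0) :
    IsLocallyFree φ := by
  intro x
  have hd := hX.hasDerivAt_comp (mdifferentiableAt_extChartAt (I := 𝓡 n) (x := x) (y := x)
    (mem_chart_source _ x))
  have hne := hd.eventually_ne (c := extChartAt (𝓡 n) x x)
    (mfderiv_extChartAt_ne_zero (mem_extChartAt_source x) (hX0 x))
  rw [eventually_nhdsWithin_iff, Metric.eventually_nhds_iff] at hne
  obtain ⟨ε, hε, h⟩ := hne
  refine ⟨ε, hε, fun t ht htε he => h (by simpa using htε) (abs_pos.1 ht) ?_⟩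
  rw [he]

/-- A smooth flow can be reparametrized by any smooth positive function. -/
theorem exists_timeChange [CompactSpace M] (hφ : IsSmoothFlow n φ) (hfree : IsLocallyFree φ)
    (hf : ContMDiff (𝓡 n) 𝓘(ℝ, ℝ) ∞ f) (hpos : ∀ x, 0 < f x) :
    ∃ ψ : Flow ℝ M, IsSmoothFlow n ψ ∧ IsLocallyFree ψ ∧ SameOrbits φ ψ ∧
      ∀ t x, φ t x = ψ (orbitIntegral φ f t x) x := by
  have hfc := hf.continuous
  have hsmooth := contMDiff_orbitIntegral hφ hf
  have hmono := strictMono_orbitIntegral (φ := φ) hfc hpos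
  choose b hb using fun (s : ℝ) (x : M) => surjective_orbitIntegral (φ := φ) hfc hpos x s
  have hb : ∀ s x, orbitIntegral φ f (b s x) x = s := hb
  have hb' : ∀ t x, b (orbitIntegral φ f t x) x = t := fun t x => (hmono x).injective (hb _ _)
  -- By strict monotonicity, `t < b s x` is equivalent to `orbitIntegral φ f t x < s`, an open
  -- condition in `(s, x)`; likewise for the reverse inequalities.
  have hbcont : Continuous fun p : ℝ × M => b p.1 p.2 := by
    refine continuous_iff_continuousAt.2 fun ⟨s, x⟩ => ?_
    have hc : ∀ t, Continuous fun p : ℝ × M => orbitIntegral φ f t p.2 := fun t =>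
      hsmooth.continuous.comp (continuous_const.prodMk continuous_snd)
    refine tendsto_order.2 ⟨fun t ht => ?_, fun t ht => ?_⟩
    · have h1 : orbitIntegral φ f t x < s := by
        rw [← hb s x]; exact hmono x ht
      filter_upwards [(hc t).continuousAt.eventually_lt
        (continuous_fst (X := ℝ) (Y := M)).continuousAt h1] with p hp
      rw [← hb p.1 p.2] at hp
      exact (hmono p.2).lt_iff_lt.1 hp
    · have h1 : s < orbitIntegral φ f t x := by
        rw [← hb s x]; exact hmono x ht
      filter_upwards [(continuous_fst (X := ℝ) (Y := M)).continuousAt.eventually_lt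
        (hc t).continuousAt h1] with p hp
      rw [← hb p.1 p.2] at hp
      exact (hmono p.2).lt_iff_lt.1 hp
  have hbsmooth : ContMDiff (𝓘(ℝ, ℝ).prod (𝓡 n)) 𝓘(ℝ, ℝ) ∞ (fun p : ℝ × M => b p.1 p.2) := by
    intro p
    refine contMDiffAt_of_implicit (I := 𝓘(ℝ, ℝ).prod (𝓡 n))
      (Φ := fun q : (ℝ × M) × ℝ => orbitIntegral φ f q.2 q.1.2) (r := fun p => p.1)
      (d := f (φ (b p.1 p.2) p.2)) ?_
      (hasDerivAt_orbitIntegral (φ := φ) hfc (b p.1 p.2) p.2) (hpos _).ne'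
      hbcont.continuousAt contMDiff_fst.contMDiffAt (Eventually.of_forall fun q => hb q.1 q.2)
    exact (hsmooth.comp (contMDiff_snd.prodMk (contMDiff_snd.comp contMDiff_fst))).contMDiffAt
  let ψ : Flow ℝ M :=
    { toFun := fun s x => φ (b s x) x
      cont' := φ.continuous hbcont continuous_snd
      map_add' := fun s₁ s₂ x => by
        rw [← φ.map_add]
        congr 1
        apply (hmono x).injective
        simp only [orbitIntegral_add hfc, hb]
        ring
      map_zero' := fun x => by
        have : b 0 x = 0 := by simpa using hb' 0 x
        rw [this, φ.map_zero_apply] }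
  have hψ : ∀ s x, ψ s x = φ (b s x) x := fun _ _ => rfl
  have hφψ : ∀ t x, φ t x = ψ (orbitIntegral φ f t x) x := fun t x => by rw [hψ, hb']
  refine ⟨ψ, ?_, fun x => ?_, fun x => ?_, hφψ⟩
  · exact ContMDiff.comp (g := fun p : ℝ × M => φ p.1 p.2) hφ (hbsmooth.prodMk contMDiff_snd)
  · obtain ⟨ε, hε, h⟩ := hfree x
    have hb0 : b 0 x = 0 := by simpa using hb' 0 x
    have hc : Tendsto (fun s => b s x) (𝓝 0) (𝓝 0) := by
      have : Continuous fun s => b s x := hbcont.comp (continuous_id.prodMk continuous_const)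
      simpa [hb0] using this.tendsto 0
    obtain ⟨δ, hδ, hδ'⟩ := Metric.eventually_nhds_iff.1
      (hc.eventually (Metric.ball_mem_nhds (0 : ℝ) hε))
    refine ⟨δ, hδ, fun t ht htδ => h (b t x) (abs_pos.2 fun h0 => ?_) ?_⟩
    · have := hb t x
      rw [h0, orbitIntegral_zero] at this
      exact abs_pos.1 ht this.symm
    · simpa using hδ' (y := t) (by simpa using htδ)
  · apply Subset.antisymm
    · rintro _ ⟨t, rfl⟩
      exact ⟨orbitIntegral φ f t x, (hφψ t x).symm⟩
    · rintro _ ⟨s, rfl⟩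
      exact ⟨b s x, rfl⟩

end TimeChange

/-! ### Recurrence and minimal sets. -/

section Dynamics

variable {M : Type*} [TopologicalSpace M] {φ ψ : Flow ℝ M}

/-- A point is (positively) recurrent if its forward orbit accumulates at it. -/
def IsRecurrent (φ : Flow ℝ M) (p : M) : Prop :=
  MapClusterPt p atTop fun t => φ t p

/-- A minimal set of a flow: a minimal nonempty closed invariant set. -/
structure IsMinimalSet (φ : Flow ℝ M) (K : Set M) : Prop where
  nonempty : K.Nonempty
  isClosed : IsClosed K
  isInvariant : IsInvariant φ K
  eq_of_subset : ∀ Z ⊆ K, Z.Nonempty → IsClosed Z → IsInvariant φ Z → Z = K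

theorem isInvariant_reverse {Z : Set M} (hZ : IsInvariant φ Z) : IsInvariant φ.reverse Z :=
  fun t => hZ (-t)

theorem isInvariant_of_reverse {Z : Set M} (hZ : IsInvariant φ.reverse Z) : IsInvariant φ Z :=
  fun t x hx => by simpa using hZ (-t) hx

theorem IsMinimalSet.reverse {K : Set M} (hK : IsMinimalSet φ K) : IsMinimalSet φ.reverse K :=
  ⟨hK.nonempty, hK.isClosed, isInvariant_reverse hK.isInvariant,
    fun Z h1 h2 h3 h4 => hK.eq_of_subset Z h1 h2 h3 (isInvariant_of_reverse h4)⟩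

theorem exists_isMinimalSet_subset [CompactSpace M] {Z : Set M} (hne : Z.Nonempty)
    (hcl : IsClosed Z) (hinv : IsInvariant φ Z) : ∃ K ⊆ Z, IsMinimalSet φ K := by
  let 𝒮 : Set (Set M) := {Y | Y.Nonempty ∧ IsClosed Y ∧ IsInvariant φ Y}
  obtain ⟨K, hKZ, hK⟩ := zorn_superset_nonempty 𝒮 (fun c hc hchain hcne => by
    refine ⟨⋂₀ c, ⟨?_, isClosed_sInter fun Y hY => (hc hY).2.1, fun t x hx Y hY =>
      (hc hY).2.2 t (hx Y hY)⟩, fun Y hY => sInter_subset_of_mem hY⟩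
    have : Nonempty c := hcne.to_subtype
    refine IsCompact.nonempty_sInter_of_directed_nonempty_isCompact_isClosed ?_
      (fun Y hY => (hc hY).1) (fun Y hY => (hc hY).2.1.isCompact) (fun Y hY => (hc hY).2.1)
    exact IsChain.directedOn (r := fun a b : Set M => a ⊇ b) hchain.symm) Z ⟨hne, hcl, hinv⟩
  refine ⟨K, hKZ, hK.prop.1, hK.prop.2.1, hK.prop.2.2, fun Y hY h1 h2 h3 => ?_⟩
  exact Subset.antisymm hY (hK.le_of_le ⟨h1, h2, h3⟩ hY)

theorem isInvariant_setOf_mapClusterPt (φ : Flow ℝ M) (x : M) :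
    IsInvariant φ {y | MapClusterPt y atTop fun t => φ t x} := by
  intro s y hy
  have h1 : MapClusterPt (φ s y) atTop (φ s ∘ fun t => φ t x) :=
    hy.continuousAt_comp (φ.continuous_toFun s).continuousAt
  have h2 : (φ s ∘ fun t => φ t x) = (fun t => φ t x) ∘ fun t => s + t := by
    ext t
    exact (φ.map_add s t x).symm
  rw [h2] at h1
  exact h1.of_comp (tendsto_atTop_add_const_left _ s tendsto_id)

theorem isClosed_setOf_mapClusterPt (φ : Flow ℝ M) (x : M) :
    IsClosed {y | MapClusterPt y atTop fun t => φ t x} :=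
  isClosed_setOfPred_clusterPt

/-- The forward limit set of `k` is nonempty by compactness, closed, invariant and contained in `K`,
hence equal to `K`. -/
theorem IsMinimalSet.isRecurrent [CompactSpace M] {K : Set M} (hK : IsMinimalSet φ K) {k : M}
    (hk : k ∈ K) : IsRecurrent φ k := by
  have hsub : {y | MapClusterPt y atTop fun t => φ t k} ⊆ K := fun y hy =>
    hK.isClosed.closure_subset (hy.clusterPt.mem_closure_of_mem _ <|
      mem_map.2 (Eventually.of_forall fun t => hK.isInvariant t hk))
  have hne : {y | MapClusterPt y atTop fun t => φ t k}.Nonempty := by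
    obtain ⟨y, hy⟩ := exists_clusterPt_of_compactSpace (map (fun t => φ t k) atTop)
    exact ⟨y, hy⟩
  have h := hK.eq_of_subset _ hsub hne (isClosed_setOf_mapClusterPt φ k)
    (isInvariant_setOf_mapClusterPt φ k)
  have hk' : k ∈ {y | MapClusterPt y atTop fun t => φ t k} := h.symm ▸ hk
  exact hk'

/-- A minimal set that contains every recurrent point lies in every limit set. -/
theorem IsMinimalSet.mapClusterPt [CompactSpace M] {K : Set M} (hK : IsMinimalSet φ K)
    (hrec : ∀ p, IsRecurrent φ p → p ∈ K) {k : M} (hk : k ∈ K) (x : M) :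
    MapClusterPt k atTop fun t => φ t x := by
  set Z := {y | MapClusterPt y atTop fun t => φ t x}
  have hne : Z.Nonempty := by
    obtain ⟨y, hy⟩ := exists_clusterPt_of_compactSpace (map (fun t => φ t x) atTop)
    exact ⟨y, hy⟩
  have hZ := isClosed_setOf_mapClusterPt φ x
  have hZi := isInvariant_setOf_mapClusterPt φ x
  obtain ⟨K', hK'Z, hK'⟩ := exists_isMinimalSet_subset hne hZ hZi
  obtain ⟨k', hk'⟩ := hK'.nonempty
  have hkK := hrec k' (hK'.isRecurrent hk')
  have h := hK.eq_of_subset (K ∩ Z) inter_subset_left ⟨k', hkK, hK'Z hk'⟩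
    (hK.isClosed.inter hZ) fun t y hy => ⟨hK.isInvariant t hy.1, hZi t hy.2⟩
  have : k ∈ K ∩ Z := h.symm ▸ hk
  exact this.2

theorem continuous_orbitIntegral_right {h : M → ℝ} (hh : Continuous h) (t : ℝ) :
    Continuous fun x => orbitIntegral φ h t x :=
  intervalIntegral.continuous_parametric_intervalIntegral_of_continuous'
    (f := fun x s => h (φ s x)) (hh.comp (φ.continuous continuous_snd continuous_fst)) 0 t

/-- A bounded monotone integral converges, so its increments over unit time tend to `0`. But
whenever the orbit returns near `p`, the increment exceeds half of the positive initial one. -/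
theorem IsRecurrent.orbitIntegral_unbounded {h : M → ℝ} (hh : Continuous h)
    (hpos : ∀ x, 0 ≤ h x) {p : M} (hp : 0 < h p) (hrec : IsRecurrent φ p) (C : ℝ) :
    ∀ᶠ t in atTop, C < orbitIntegral φ h t p := by
  have hmono := monotone_orbitIntegral (φ := φ) hh hpos
  suffices H : ¬ BddAbove (range fun t => orbitIntegral φ h t p) by
    obtain ⟨_, ⟨t, rfl⟩, ht⟩ := not_bddAbove_iff.1 H C
    filter_upwards [eventually_ge_atTop t] with s hs using ht.trans_le (hmono p hs)
  intro hbdd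
  have hlim := tendsto_atTop_ciSup (hmono p) hbdd
  have h1 : 0 < orbitIntegral φ h 1 p :=
    intervalIntegral.integral_pos zero_lt_one (continuous_comp_orbit φ hh p).continuousOn
      (fun _ _ => hpos _) ⟨0, by simp, by simpa using hp⟩
  have hdiff : Tendsto (fun t => orbitIntegral φ h (1 + t) p - orbitIntegral φ h t p) atTop
      (𝓝 0) := by
    simpa using (hlim.comp (tendsto_atTop_add_const_left _ 1 tendsto_id)).sub hlim
  have hsmall := hdiff.eventually (gt_mem_nhds (half_pos h1))
  have hnear : {x | orbitIntegral φ h 1 p / 2 < orbitIntegral φ h 1 x} ∈ 𝓝 p :=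
    (continuous_orbitIntegral_right hh 1).continuousAt.eventually (lt_mem_nhds (half_lt_self h1))
  obtain ⟨t, ht1, ht2⟩ := ((hrec.frequently hnear).and_eventually hsmall).exists
  rw [orbitIntegral_add hh, add_sub_cancel_left] at ht2
  exact lt_asymm ht1 ht2

theorem IsLocallyFree.reverse (hfree : IsLocallyFree φ) : IsLocallyFree φ.reverse := fun x => by
  obtain ⟨ε, hε, h⟩ := hfree x
  exact ⟨ε, hε, fun t h1 h2 => h (-t) (by rwa [abs_neg]) (by rwa [abs_neg])⟩

theorem exists_nhds_of_not_isRecurrent {p : M} (hp : ¬ IsRecurrent φ p) :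
    ∃ V ∈ 𝓝 p, ∃ T : ℝ, ∀ t ≥ T, φ t p ∉ V := by
  rw [IsRecurrent, mapClusterPt_iff_frequently] at hp
  push Not at hp
  obtain ⟨V, hV, h⟩ := hp
  exact ⟨V, hV, eventually_atTop.1 h⟩

theorem orbitIntegral_eq_of_forall_eq_zero {h : M → ℝ} (hh : Continuous h) {s t : ℝ} {x : M}
    (h0 : ∀ r ∈ uIcc s t, h (φ r x) = 0) : orbitIntegral φ h t x = orbitIntegral φ h s x := by
  have hi := fun a b => (continuous_comp_orbit φ hh x).intervalIntegrable (μ := volume) a b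
  rw [orbitIntegral, orbitIntegral, ← sub_eq_zero,
    intervalIntegral.integral_interval_sub_left (hi _ _) (hi _ _),
    intervalIntegral.integral_congr (g := fun _ => (0 : ℝ)) h0]
  simp

end Dynamics

/-! ### Conjugacies between a flow and its time change. -/

section Conjugacy

variable {M : Type*} [TopologicalSpace M] {φ ψ ψ₁ ψ₂ : Flow ℝ M} {f h : M → ℝ}
  {F F₁ F₂ : M ≃ₜ M} {c : ℝ}

/-- `ψ` is the time change of `φ` by the function `f`, and `F` is an orbit-preserving
homeomorphism that conjugates `φ`, with time multiplied by `c`, to `ψ`. -/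
structure IsTimeChangeConj (φ ψ : Flow ℝ M) (f : M → ℝ) (F : M ≃ₜ M) (c : ℝ) : Prop where
  flow_eq : ∀ t x, φ t x = ψ (orbitIntegral φ f t x) x
  sameOrbits : SameOrbits φ ψ
  mem_orbit : ∀ x, F x ∈ φ.orbit x
  conj : ∀ x t, F (φ t x) = ψ (c * t) (F x)
  ne_zero : c ≠ 0

theorem orbit_reverse (φ : Flow ℝ M) (x : M) : φ.reverse.orbit x = φ.orbit x := by
  ext y
  constructor
  · rintro ⟨t, rfl⟩
    exact ⟨-t, rfl⟩
  · rintro ⟨t, rfl⟩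
    exact ⟨-t, by change φ (- -t) x = φ t x; rw [neg_neg]⟩

theorem IsTimeChangeConj.reverse (H : IsTimeChangeConj φ ψ f F c) :
    IsTimeChangeConj φ.reverse ψ.reverse f F c where
  flow_eq t x := by
    rw [orbitIntegral_reverse, Flow.reverse_apply, Flow.reverse_apply, neg_neg, H.flow_eq]
  sameOrbits x := by rw [orbit_reverse, orbit_reverse, H.sameOrbits]
  mem_orbit x := by rw [orbit_reverse]; exact H.mem_orbit x
  conj x t := by rw [Flow.reverse_apply, Flow.reverse_apply, H.conj, mul_neg]
  ne_zero := H.ne_zero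

theorem IsTimeChangeConj.exists_eq (H : IsTimeChangeConj φ ψ f F c) (x : M) :
    ∃ v, ψ v x = F x := by
  have := H.mem_orbit x
  rw [H.sameOrbits x] at this
  exact this

theorem flow_comm (φ : Flow ℝ M) (s t : ℝ) (x : M) : φ s (φ t x) = φ t (φ s x) := by
  rw [← φ.map_add, ← φ.map_add, add_comm]

theorem flow_neg_eq_self {t : ℝ} {x : M} (ht : φ t x = x) : φ (-t) x = x := by
  nth_rewrite 1 [← ht]
  rw [← φ.map_add, neg_add_cancel, φ.map_zero_apply]

theorem flow_abs_eq_self {t : ℝ} {x : M} (ht : φ t x = x) : φ |t| x = x := by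
  rcases abs_choice t with h | h <;> rw [h]
  · exact ht
  · exact flow_neg_eq_self ht

theorem flow_sub_eq_self {s t : ℝ} {x : M} (h : φ s x = φ t x) : φ (s - t) x = x := by
  rw [sub_eq_neg_add, φ.map_add, h, ← φ.map_add, neg_add_cancel, φ.map_zero_apply]

/-- For the minimal `φ`-period `T₀` of `p`, the minimal `ψ`-period is the integral of `f` over `T₀`.
The conjugacy makes it `|c| * T₀` as well; the two inequalities express minimality on either side.
-/
theorem IsTimeChangeConj.exists_period [T2Space M] [CompactSpace M]
    (H : IsTimeChangeConj φ ψ f F c) (hf : Continuous f) (hpos : ∀ x, 0 < f x)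
    (hfree : IsLocallyFree φ) {p : M} {T : ℝ} (hT : 0 < T) (hTp : φ T p = p) :
    ∃ T₀ > 0, φ T₀ p = p ∧ orbitIntegral φ f T₀ p = |c| * T₀ := by
  have hc := abs_pos.2 H.ne_zero
  have hmono := strictMono_orbitIntegral (φ := φ) hf hpos p
  obtain ⟨ε, hε, hεp⟩ := hfree p
  have hge : ∀ t > 0, φ t p = p → ε ≤ t := fun t ht htp => by
    by_contra hlt
    exact hεp t (abs_pos.2 ht.ne') (by rw [abs_of_pos ht]; linarith) htp
  have hcl : IsClosed {t | φ t p = p} :=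
    isClosed_eq (φ.continuous continuous_id continuous_const) continuous_const
  obtain ⟨T₀, hT₀, hmin⟩ := ((isCompact_Icc (a := ε) (b := T)).inter_right hcl).exists_isLeast
    ⟨T, ⟨hge T hT hTp, le_rfl⟩, hTp⟩
  have hT₀p : φ T₀ p = p := hT₀.2
  have hT₀pos : 0 < T₀ := hε.trans_le hT₀.1.1
  have hle : ∀ t > 0, φ t p = p → T₀ ≤ t := fun t ht htp => by
    rcases le_total t T with h | h
    · exact hmin ⟨⟨hge t ht htp, h⟩, htp⟩
    · exact hT₀.1.2.trans h
  obtain ⟨v, hv⟩ := H.exists_eq p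
  -- `F p` lies on the `ψ`-orbit of `p`, and points of one orbit have the same periods.
  have hpsi : ∀ s, ψ s (F p) = F p ↔ ψ s p = p := fun s => by
    rw [← hv, flow_comm]
    exact (ψ.toHomeomorph v).injective.eq_iff
  refine ⟨T₀, hT₀pos, hT₀p, le_antisymm ?_ ?_⟩
  · have h1 : ψ (c * T₀) p = p := by rw [← hpsi, ← H.conj, hT₀p]
    have h2 : ψ (|c| * T₀) p = p := by
      have := flow_abs_eq_self h1
      rwa [abs_mul, abs_of_pos hT₀pos] at this
    obtain ⟨t, ht⟩ := surjective_orbitIntegral (φ := φ) hf hpos p (|c| * T₀)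
    have ht : orbitIntegral φ f t p = |c| * T₀ := ht
    have htp : φ t p = p := by rw [H.flow_eq, ht, h2]
    have htpos : 0 < t := by
      rw [← hmono.lt_iff_lt]
      simp only [orbitIntegral_zero, ht]
      positivity
    rw [← ht]
    exact hmono.monotone (hle t htpos htp)
  · have hSpos : 0 < orbitIntegral φ f T₀ p := by simpa using hmono hT₀pos
    have h1 : ψ (orbitIntegral φ f T₀ p) p = p := by rw [← H.flow_eq, hT₀p]
    have h2 : φ (orbitIntegral φ f T₀ p / c) p = p := by
      apply F.injective
      rw [H.conj, mul_div_cancel₀ _ H.ne_zero, hpsi, h1]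
    have h3 := hle _ (abs_pos.2 (div_ne_zero hSpos.ne' H.ne_zero)) (flow_abs_eq_self h2)
    rw [abs_div, abs_of_pos hSpos, le_div_iff₀ hc] at h3
    linarith

theorem orbitIntegral_nat_mul {p : M} {T : ℝ} (hf : Continuous f) (hTp : φ T p = p) (k : ℕ) :
    φ (k * T) p = p ∧ orbitIntegral φ f (k * T) p = k * orbitIntegral φ f T p := by
  induction k with
  | zero => simp
  | succ k ih =>
    have h1 : ((k + 1 : ℕ) : ℝ) * T = k * T + T := by push_cast; ring
    rw [h1, φ.map_add, hTp, orbitIntegral_add hf, hTp, ih.2]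
    exact ⟨ih.1, by push_cast; ring⟩

theorem isClosed_setOf_exists_flow_eq [T2Space M] [CompactSpace M] (ψ : Flow ℝ M) {F : M → M}
    (hF : Continuous F) (k : ℝ) : IsClosed {x | ∃ v ∈ Icc (-k) k, ψ v x = F x} := by
  have h1 : IsClosed {q : ℝ × M | ψ q.1 q.2 = F q.2} :=
    isClosed_eq (ψ.continuous continuous_fst continuous_snd) (hF.comp continuous_snd)
  have h2 := (((isCompact_Icc (a := -k) (b := k)).prod (isCompact_univ (X := M))).inter_right
    h1).image continuous_snd
  convert h2.isClosed using 1
  ext x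
  constructor
  · rintro ⟨v, hv, hx⟩
    exact ⟨(v, x), ⟨⟨hv, mem_univ _⟩, hx⟩, rfl⟩
  · rintro ⟨⟨v, y⟩, ⟨⟨hv, -⟩, hy⟩, rfl⟩
    exact ⟨v, hv, hy⟩

/-- On a nonempty closed set `Z`, the displacement of `F` is bounded on a relatively open
subset. -/
theorem IsTimeChangeConj.exists_isOpen_bounded [T2Space M] [CompactSpace M]
    (H : IsTimeChangeConj φ ψ f F c) {Z : Set M} (hZ : IsClosed Z) (hne : Z.Nonempty) :
    ∃ U : Set M, IsOpen U ∧ (U ∩ Z).Nonempty ∧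
      ∃ k : ℝ, ∀ x ∈ U ∩ Z, ∃ v ∈ Icc (-k) k, ψ v x = F x := by
  have : CompactSpace Z := isCompact_iff_compactSpace.1 hZ.isCompact
  have : Nonempty Z := hne.to_subtype
  let A : ℕ → Set Z := fun k => Subtype.val ⁻¹' {x | ∃ v ∈ Icc (-(k : ℝ)) k, ψ v x = F x}
  -- Baire in the compact space `Z`: the closed sets with displacement at most `k` cover it.
  obtain ⟨k, z, hz⟩ := nonempty_interior_of_iUnion_of_closed (f := A)
    (fun k => (isClosed_setOf_exists_flow_eq ψ F.continuous k).preimage continuous_subtype_val)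
    (eq_univ_of_forall fun x => by
      obtain ⟨v, hv⟩ := H.exists_eq (x : M)
      obtain ⟨k, hk⟩ := exists_nat_ge |v|
      exact mem_iUnion.2 ⟨k, v, abs_le.1 hk, hv⟩)
  obtain ⟨U, hU, hUi⟩ := isOpen_induced_iff.1 (isOpen_interior (s := A k))
  refine ⟨U, hU, ⟨z, ?_, z.2⟩, k, fun x hx => ?_⟩
  · have : z ∈ Subtype.val ⁻¹' U := hUi ▸ hz
    exact this
  · have : (⟨x, hx.2⟩ : Z) ∈ interior (A k) := by
      rw [← hUi]
      exact hx.1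
    exact (interior_subset this : (⟨x, hx.2⟩ : Z) ∈ A k)

/-- The displacement of `F` along an aperiodic orbit. -/
theorem IsTimeChangeConj.displacement_eq (H : IsTimeChangeConj φ ψ f F c) {x : M}
    (hx : ∀ s, ψ s x = x → s = 0) {t v w : ℝ} (hv : ψ v x = F x)
    (hw : ψ w (φ t x) = F (φ t x)) : w + orbitIntegral φ f t x = c * t + v := by
  have h1 : ψ (w + orbitIntegral φ f t x) x = ψ (c * t + v) x := by
    rw [ψ.map_add, ← H.flow_eq, hw, H.conj, ← hv, ← ψ.map_add]
  exact sub_eq_zero.1 (hx _ (flow_sub_eq_self h1))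

theorem IsTimeChangeConj.aperiodic [CompactSpace M] (H : IsTimeChangeConj φ ψ f F c)
    (hf : Continuous f) (hpos : ∀ x, 0 < f x) {x : M} (hx : ∀ t, φ t x = x → t = 0) (s : ℝ)
    (hs : ψ s x = x) : s = 0 := by
  obtain ⟨t, rfl⟩ := surjective_orbitIntegral (φ := φ) hf hpos x s
  have : t = 0 := hx t (by rw [H.flow_eq]; exact hs)
  simp [this]

/-- The factor `|c|` is the mean of `f` along returns of a recurrent orbit. On a periodic orbit the
error vanishes at multiples of the period. Otherwise the displacement is bounded on a relatively
open part of the orbit closure; the orbit returns there infinitely often, and the displacement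
equation bounds the error at those times. -/
theorem IsTimeChangeConj.frequently_bounded [T2Space M] [CompactSpace M]
    (H : IsTimeChangeConj φ ψ f F c) (hf : Continuous f) (hpos : ∀ x, 0 < f x)
    (hfree : IsLocallyFree φ) {p : M} (hrec : IsRecurrent φ p) :
    ∃ C, ∃ᶠ t in atTop, |orbitIntegral φ f t p - |c| * t| ≤ C := by
  by_cases hper : ∃ T, φ T p = p ∧ T ≠ 0
  · obtain ⟨T, hTp, hT⟩ := hper
    obtain ⟨T₀, hT₀, hT₀p, hS⟩ := H.exists_period hf hpos hfree (abs_pos.2 hT)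
      (flow_abs_eq_self hTp)
    refine ⟨0, frequently_atTop.2 fun a => ?_⟩
    obtain ⟨k, hk⟩ := exists_nat_ge (a / T₀)
    refine ⟨k * T₀, (div_le_iff₀ hT₀).1 hk, ?_⟩
    rw [(orbitIntegral_nat_mul hf hT₀p k).2, hS]
    have : (k : ℝ) * (|c| * T₀) - |c| * (k * T₀) = 0 := by ring
    rw [this, abs_zero]
  push Not at hper
  have hap := H.aperiodic hf hpos hper
  obtain ⟨U, hU, ⟨z, hzU, hz⟩, k, hk⟩ := H.exists_isOpen_bounded
    (isClosed_closure (s := φ.orbit p)) ((φ.nonempty_orbit p).closure)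
  obtain ⟨_, hqU, s, rfl⟩ := mem_closure_iff.1 hz U hU hzU
  replace hqU : φ s p ∈ U := hqU
  obtain ⟨v, hv, hvq⟩ := hk _ ⟨hqU, subset_closure (φ.mem_orbit p s)⟩
  -- `B` is the cost of replacing the base point `φ s p`, which lies in `U`, by `p`.
  obtain ⟨B, hB⟩ := isCompact_univ.exists_bound_of_continuousOn
    ((continuous_orbitIntegral_right (φ := φ) hf s).continuousOn (s := univ))
  have hev : ∃ᶠ t in atTop, φ s (φ t p) ∈ U :=
    hrec.frequently ((φ.continuous_toFun s).continuousAt.preimage_mem_nhds (hU.mem_nhds hqU))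
  have hqap : ∀ r, ψ r (φ s p) = φ s p → r = 0 := fun r hr => by
    apply hap r
    rw [H.flow_eq s p, flow_comm] at hr
    exact (ψ.toHomeomorph _).injective hr
  refine ⟨2 * k + 2 * B, (hev.and_eventually (eventually_ge_atTop 0)).mono ?_⟩
  rintro t ⟨htU, ht⟩
  rw [flow_comm] at htU
  have hmem : φ t (φ s p) ∈ closure (φ.orbit p) := by
    rw [← φ.map_add]
    exact subset_closure (φ.mem_orbit p _)
  obtain ⟨w, hw, hwq⟩ := hk _ ⟨htU, hmem⟩
  have h1 := H.displacement_eq hqap hvq hwq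
  have h2 : orbitIntegral φ f s p + orbitIntegral φ f t (φ s p) =
      orbitIntegral φ f t p + orbitIntegral φ f s (φ t p) := by
    rw [← orbitIntegral_add hf, ← orbitIntegral_add hf, add_comm]
  have h3 := abs_le.1 (hB p (mem_univ _))
  have h4 := abs_le.1 (hB (φ t p) (mem_univ _))
  have h5 : |orbitIntegral φ f t p - c * t| ≤ 2 * k + 2 * B := by
    rw [abs_le]
    constructor <;> linarith [hv.1, hv.2, hw.1, hw.2, h3.1, h3.2, h4.1, h4.2]
  have h6 := (abs_abs_sub_abs_le (orbitIntegral φ f t p) (c * t)).trans h5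
  have h7 : 0 ≤ orbitIntegral φ f t p := by
    simpa using (strictMono_orbitIntegral (φ := φ) hf hpos p).monotone ht
  rwa [abs_of_nonneg h7, abs_mul, abs_of_nonneg ht] at h6

/-- If `f = 1` along the orbit of some recurrent point, then time is multiplied by `±1`. -/
theorem IsTimeChangeConj.abs_eq_one [T2Space M] [CompactSpace M]
    (H : IsTimeChangeConj φ ψ f F c) (hf : Continuous f) (hpos : ∀ x, 0 < f x)
    (hfree : IsLocallyFree φ) {k : M} (hrec : IsRecurrent φ k) (hk : ∀ t, f (φ t k) = 1) :
    |c| = 1 := by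
  obtain ⟨C, hC⟩ := H.frequently_bounded hf hpos hfree hrec
  by_contra hne
  have h1 : ∀ t, orbitIntegral φ f t k = t := fun t => by simp [orbitIntegral, hk]
  have h2 : 0 < |(1 : ℝ) - (|c|)| := abs_pos.2 (sub_ne_zero.2 (Ne.symm hne))
  obtain ⟨t, ht, ht'⟩ := (hC.and_eventually
    ((eventually_gt_atTop (C / |(1 : ℝ) - (|c|)|)).and (eventually_ge_atTop 0))).exists
  rw [h1, show t - |c| * t = (1 - |c|) * t by ring, abs_mul, abs_of_nonneg ht'.2] at ht
  have := (div_lt_iff₀ h2).1 ht'.1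
  linarith

/-- The recurrent point `k` forces `|c| = 1`, so the integral of `h` along the orbit of `p` would
have to be bounded at arbitrarily large times; recurrence excludes this when `h p > 0`. -/
theorem IsTimeChangeConj.eq_zero_of_isRecurrent [T2Space M] [CompactSpace M]
    (H : IsTimeChangeConj φ ψ (fun x => 1 + 1 * h x) F c) (hh : Continuous h)
    (hnn : ∀ x, 0 ≤ h x) (hfree : IsLocallyFree φ) {k : M} (hrec : IsRecurrent φ k)
    (hk : ∀ t, h (φ t k) = 0) {p : M} (hp : IsRecurrent φ p) : h p = 0 := by
  by_contra hne
  have hf : Continuous fun x => 1 + 1 * h x := by fun_prop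
  have hpos : ∀ x, 0 < 1 + 1 * h x := fun x => by linarith [hnn x]
  have hc := H.abs_eq_one hf hpos hfree hrec (fun t => by simp [hk])
  obtain ⟨C, hC⟩ := H.frequently_bounded hf hpos hfree hp
  obtain ⟨t, ht, ht'⟩ := (hC.and_eventually
    (hp.orbitIntegral_unbounded hh hnn (lt_of_le_of_ne (hnn p) (Ne.symm hne)) C)).exists
  rw [orbitIntegral_one_add hh, hc] at ht
  have := (abs_le.1 ht).2
  linarith

/-- Compare two conjugacies with the same time factor whose time changes have constant
displacement `d` from each other along `φ t p` as `t` goes to infinity. -/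
theorem IsTimeChangeConj.flow_eq_of_mapClusterPt [T2Space M] {f₁ f₂ : M → ℝ}
    (H₁ : IsTimeChangeConj φ ψ₁ f₁ F₁ c) (H₂ : IsTimeChangeConj φ ψ₂ f₂ F₂ c)
    {p k : M} {w e₁ e₂ : ℝ} (hw : F₂ (F₁.symm p) = ψ₂ w p) {l : Filter ℝ}
    (hl : ∀ s, Tendsto (fun t => s + t) l l)
    (he₁ : ∀ᶠ t in l, orbitIntegral φ f₁ t p = t + e₁)
    (he₂ : ∀ᶠ t in l, orbitIntegral φ f₂ t p = t + e₂)
    (hk : MapClusterPt k l fun t => φ t p) :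
    F₂ (F₁.symm k) = φ (w + (e₁ - e₂)) k := by
  -- Since both conjugacies have the same `c`, the composite `F₂ ∘ F₁⁻¹` takes `ψ₁` to `ψ₂` without
  -- rescaling time.
  have hG : ∀ s y, F₂ (F₁.symm (ψ₁ s y)) = ψ₂ s (F₂ (F₁.symm y)) := fun s y => by
    have h1 : ψ₁ s y = F₁ (φ (s / c) (F₁.symm y)) := by
      rw [H₁.conj, mul_div_cancel₀ _ H₁.ne_zero, F₁.apply_symm_apply]
    rw [h1, F₁.symm_apply_apply, H₂.conj, mul_div_cancel₀ _ H₁.ne_zero]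
  -- The claimed identity is a closed condition, so it passes from the points `φ t p` to their
  -- cluster point `k`.
  have hcl : IsClosed {y | F₂ (F₁.symm y) = φ (w + (e₁ - e₂)) y} :=
    isClosed_eq (F₂.continuous.comp F₁.symm.continuous) (φ.continuous_toFun _)
  refine hcl.closure_subset (hk.clusterPt.mem_closure_of_mem _ (mem_map.2 ?_))
  filter_upwards [he₁, (hl (w + (e₁ - e₂))).eventually he₂] with t h1 h2
  change F₂ (F₁.symm (φ t p)) = φ (w + (e₁ - e₂)) (φ t p)
  rw [← φ.map_add, H₂.flow_eq (_ + t), h2, H₁.flow_eq, h1, hG, hw, ← ψ₂.map_add]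
  congr 1
  ring

end Conjugacy

/-! ### Parameter rigid flows are minimal. -/

section Minimality

variable {n : ℕ} {M : Type*} [TopologicalSpace M] [ChartedSpace (EuclideanSpace ℝ (Fin n)) M]
  [IsManifold (𝓡 n) ∞ M] [CompactSpace M] {φ : Flow ℝ M} {f : M → ℝ}

theorem IsParameterRigid.exists_isTimeChangeConj (hrig : IsParameterRigid n φ)
    (hφ : IsSmoothFlow n φ) (hfree : IsLocallyFree φ) (hf : ContMDiff (𝓡 n) 𝓘(ℝ, ℝ) ∞ f)
    (hpos : ∀ x, 0 < f x) :
    ∃ (ψ : Flow ℝ M) (F : M ≃ₜ M) (c : ℝ), IsSmoothFlow n ψ ∧ IsLocallyFree ψ ∧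
      ContMDiff (𝓡 n) (𝓡 n) ∞ F ∧ IsTimeChangeConj φ ψ f F c := by
  obtain ⟨ψ, hψ, hψfree, horb, hflow⟩ := exists_timeChange hφ hfree hf hpos
  obtain ⟨F, A, hF, hconj⟩ := hrig ψ hψ hψfree horb
  refine ⟨ψ, F.toHomeomorph, A 1, hψ, hψfree, F.contMDiff, hflow, horb, fun x => ?_,
    fun x t => ?_, ?_⟩
  · rw [← hF x]
    exact mem_image_of_mem F (φ.mem_orbit_self x)
  · have h1 : A t = A 1 * t := by
      have := map_real_smul A A.continuous t 1
      rw [smul_eq_mul, mul_one, smul_eq_mul] at this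
      rw [this, mul_comm]
    rw [← h1]
    exact hconj x t
  · intro h0
    have : (1 : ℝ) = 0 := A.injective (h0.trans (_root_.map_zero A).symm)
    exact one_ne_zero this

variable [T2Space M]

/-- A minimal set of a parameter rigid flow contains all recurrent points. -/
theorem IsParameterRigid.mem_of_isRecurrent (hrig : IsParameterRigid n φ)
    (hφ : IsSmoothFlow n φ) (hfree : IsLocallyFree φ) {K : Set M} (hK : IsMinimalSet φ K) :
    (∀ p, IsRecurrent φ p → p ∈ K) ∧ ∀ p, IsRecurrent φ.reverse p → p ∈ K := by
  -- A smooth nonnegative function with zero set exactly `K`.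
  obtain ⟨h, hsupp, hsm, hnn⟩ := hK.isClosed.isOpen_compl.exists_contMDiff_support_eq
    (n := ⊤) (𝓡 n)
  have hhK : ∀ x, h x = 0 ↔ x ∈ K := fun x => by
    have : x ∈ h.support ↔ x ∈ Kᶜ := by rw [hsupp]
    simpa [not_iff_not] using this
  obtain ⟨k, hk⟩ := hK.nonempty
  have hf : ContMDiff (𝓡 n) 𝓘(ℝ, ℝ) ∞ (fun x => 1 + 1 * h x) :=
    contMDiff_const.add (contMDiff_const.mul hsm)
  obtain ⟨ψ, F, c, -, -, -, H⟩ := hrig.exists_isTimeChangeConj hφ hfree hf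
    (fun x => by linarith [hnn x])
  refine ⟨fun p hp => (hhK p).1 ?_, fun p hp => (hhK p).1 ?_⟩
  · exact H.eq_zero_of_isRecurrent hsm.continuous hnn hfree (hK.isRecurrent hk)
      (fun t => (hhK _).2 (hK.isInvariant t hk)) hp
  · exact H.reverse.eq_zero_of_isRecurrent hsm.continuous hnn hfree.reverse
      (hK.reverse.isRecurrent hk) (fun t => (hhK _).2 (hK.reverse.isInvariant t hk)) hp

/-- A parameter rigid flow is minimal. -/
theorem IsParameterRigid.eq_univ_of_isMinimalSet (hrig : IsParameterRigid n φ)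
    (hφ : IsSmoothFlow n φ) (hfree : IsLocallyFree φ) {K : Set M} (hK : IsMinimalSet φ K) :
    K = univ := by
  by_contra hne
  obtain ⟨p, hp⟩ := (ne_univ_iff_exists_notMem K).1 hne
  obtain ⟨hrec, hrec'⟩ := hrig.mem_of_isRecurrent hφ hfree hK
  obtain ⟨V₁, hV₁, T₁, hT₁⟩ := exists_nhds_of_not_isRecurrent fun h => hp (hrec p h)
  obtain ⟨V₂, hV₂, T₂, hT₂⟩ := exists_nhds_of_not_isRecurrent fun h => hp (hrec' p h)
  obtain ⟨T, hT0, hTT₁, hTT₂⟩ : ∃ T : ℝ, 0 < T ∧ T₁ ≤ T ∧ T₂ ≤ T :=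
    ⟨max 1 (max T₁ T₂), by positivity, (le_max_left _ _).trans (le_max_right _ _),
      (le_max_right _ _).trans (le_max_right _ _)⟩
  obtain ⟨k, hk⟩ := hK.nonempty
  have hclus : ∀ y ∈ K, MapClusterPt y atTop fun t => φ t p := fun y hy =>
    hK.mapClusterPt hrec hy p
  have hclus' : MapClusterPt k atBot fun t => φ t p :=
    (hK.reverse.mapClusterPt hrec' hk p).of_comp (φ := fun t : ℝ => -t)
      (u := fun t => φ t p) tendsto_neg_atTop_atBot
  -- A bump around `p` that the orbit of `p` meets only at times in `(-T, T)`.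
  obtain ⟨h, hsupp, hsm, hnn⟩ := (isOpen_interior (s := V₁ ∩ V₂)).exists_contMDiff_support_eq
    (n := ⊤) (𝓡 n)
  have hh := hsm.continuous
  have hzero : ∀ x, x ∉ interior (V₁ ∩ V₂) → h x = 0 := fun x hx => by
    rw [← hsupp] at hx
    simpa using hx
  have hptop : ∀ t ≥ T, h (φ t p) = 0 := fun t ht =>
    hzero _ fun hmem => hT₁ t (hTT₁.trans ht) (interior_subset hmem).1
  have hpbot : ∀ t ≤ -T, h (φ t p) = 0 := fun t ht =>
    hzero _ fun hmem => hT₂ (-t) (by linarith) (by simpa using (interior_subset hmem).2)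
  -- A point of `K` in the support would be approached by `φ s p` with `s ≥ T`, when the orbit
  -- already avoids `V₁`.
  have hKzero : ∀ t, h (φ t k) = 0 := fun t => hzero _ fun hmem => by
    obtain ⟨s, hs1, hs2⟩ := (((hclus _ (hK.isInvariant t hk)).frequently
      (isOpen_interior.mem_nhds hmem)).and_eventually (eventually_ge_atTop T)).exists
    exact hT₁ s (hTT₁.trans hs2) (interior_subset hs1).1
  have hppos : 0 < h p := by
    have : p ∈ h.support := by
      rw [hsupp]
      exact mem_interior_iff_mem_nhds.2 (inter_mem hV₁ hV₂)
    exact lt_of_le_of_ne (hnn p) (Ne.symm this)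
  set Hp := orbitIntegral φ h T p with hHp
  set Hm := orbitIntegral φ h (-T) p with hHm
  have hH : 0 < Hp - Hm := by
    have h1 : 0 < Hp := intervalIntegral.integral_pos hT0
      (continuous_comp_orbit φ hh p).continuousOn (fun _ _ => hnn _)
      ⟨0, ⟨le_rfl, hT0.le⟩, by simpa using hppos⟩
    have h2 : Hm ≤ 0 := by
      have := monotone_orbitIntegral (φ := φ) hh hnn p (show -T ≤ 0 by linarith)
      simpa using this
    linarith
  have htop : ∀ l : ℝ, ∀ᶠ t in atTop,
      orbitIntegral φ (fun x => 1 + l * h x) t p = t + l * Hp := fun l => by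
    filter_upwards [eventually_ge_atTop T] with t ht
    rw [orbitIntegral_one_add hh, orbitIntegral_eq_of_forall_eq_zero hh (s := T) (t := t)]
    intro r hr
    rw [uIcc_of_le ht] at hr
    exact hptop r hr.1
  have hbot : ∀ l : ℝ, ∀ᶠ t in atBot,
      orbitIntegral φ (fun x => 1 + l * h x) t p = t + l * Hm := fun l => by
    filter_upwards [eventually_le_atBot (-T)] with t ht
    rw [orbitIntegral_one_add hh, orbitIntegral_eq_of_forall_eq_zero hh (s := -T) (t := t)]
    intro r hr
    rw [uIcc_of_ge ht] at hr
    exact hpbot r hr.2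
  obtain ⟨ε, hε, hεk⟩ := hfree k
  -- Scaled so that the shifts at the two ends of the orbit of `p` differ by `(j - i) * (ε / 3)`,
  -- which lies in `(0, ε)` for `i < j ≤ 2`.
  let l : ℕ → ℝ := fun i => i * (ε / (3 * (Hp - Hm)))
  have hl : ∀ i, 0 ≤ l i := fun i => by positivity
  have hpos : ∀ i x, 0 < 1 + l i * h x := fun i x => by
    have := mul_nonneg (hl i) (hnn x)
    linarith
  have hsml : ∀ i, ContMDiff (𝓡 n) 𝓘(ℝ, ℝ) ∞ (fun x => 1 + l i * h x) := fun i =>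
    contMDiff_const.add (contMDiff_const.mul hsm)
  choose ψ F c _ _ _ H using fun i => hrig.exists_isTimeChangeConj hφ hfree (hsml i) (hpos i)
  have hc : ∀ i, |c i| = 1 := fun i => (H i).abs_eq_one (hsml i).continuous (hpos i) hfree
    (hK.isRecurrent hk) fun t => by simp [hKzero]
  -- If `c i = c j`, then `F j ∘ (F i)⁻¹` moves `k` by one shift, read off as `t → +∞`, and also by
  -- another, read off as `t → -∞`. The difference is a period of `k` smaller than `ε`.
  have key : ∀ i j : ℕ, i < j → j < 3 → c i ≠ c j := by
    intro i j hij hj hcij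
    have Hi : IsTimeChangeConj φ (ψ i) (fun x => 1 + l i * h x) (F i) (c j) := hcij ▸ H i
    obtain ⟨w, hw⟩ : ∃ w, ψ j w p = F j ((F i).symm p) := by
      have h1 := (H i).mem_orbit ((F i).symm p)
      rw [(F i).apply_symm_apply] at h1
      obtain ⟨r, hr⟩ := φ.mem_orbit_iff.1 h1
      obtain ⟨s, hs⟩ := φ.mem_orbit_iff.1 ((H j).mem_orbit ((F i).symm p))
      have h2 : F j ((F i).symm p) ∈ φ.orbit p := by
        refine φ.mem_orbit_iff.2 ⟨s - r, ?_⟩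
        nth_rewrite 1 [← hr]
        rw [← φ.map_add, sub_add_cancel, hs]
      rw [(H j).sameOrbits p] at h2
      exact h2
    have e1 := Hi.flow_eq_of_mapClusterPt (H j) hw.symm
      (fun s => tendsto_atTop_add_const_left _ s tendsto_id) (htop _) (htop _) (hclus k hk)
    have e2 := Hi.flow_eq_of_mapClusterPt (H j) hw.symm
      (fun s => tendsto_atBot_add_const_left _ s tendsto_id) (hbot _) (hbot _) hclus'
    have e3 := flow_sub_eq_self (e2.symm.trans e1)
    have e4 : w + (l i * Hm - l j * Hm) - (w + (l i * Hp - l j * Hp)) =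
        ((j : ℝ) - i) * (ε / 3) := by
      simp only [l]
      field_simp
      ring
    rw [e4] at e3
    have hij' : (i : ℝ) < j := by exact_mod_cast hij
    have hj' : (j : ℝ) ≤ 2 := by exact_mod_cast Nat.lt_succ_iff.1 hj
    have hi' : (0 : ℝ) ≤ i := by positivity
    have hpos' : 0 < ((j : ℝ) - i) * (ε / 3) := mul_pos (sub_pos.2 hij') (by positivity)
    refine hεk _ (abs_pos.2 hpos'.ne') ?_ e3
    rw [abs_of_pos hpos']
    nlinarith
  have hc' : ∀ i, c i = 1 ∨ c i = -1 := fun i => eq_or_eq_neg_of_abs_eq (hc i)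
  have k01 := key 0 1 (by norm_num) (by norm_num)
  have k02 := key 0 2 (by norm_num) (by norm_num)
  have k12 := key 1 2 (by norm_num) (by norm_num)
  -- Three numbers in `{1, -1}` cannot be pairwise distinct.
  rcases hc' 0 with h0 | h0 <;> rcases hc' 1 with h1 | h1 <;> rcases hc' 2 with h2 | h2 <;>
    simp [h0, h1, h2] at k01 k02 k12

end Minimality

/-! ### Rigidity implies solvability of the cohomological equation. -/

section Necessity

variable {n : ℕ} {M : Type*} [TopologicalSpace M] [ChartedSpace (EuclideanSpace ℝ (Fin n)) M]
  {φ ψ : Flow ℝ M} {X : (x : M) → TangentSpace (𝓡 n) x} {f : M → ℝ} {F : M ≃ₜ M} {c : ℝ}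

theorem orbitIntegral_sub_const (hf : Continuous f) (c t : ℝ) (x : M) :
    orbitIntegral φ (fun y => f y - c) t x = orbitIntegral φ f t x - c * t := by
  have hi := (continuous_comp_orbit φ hf x).intervalIntegrable (μ := volume) 0 t
  simp only [orbitIntegral]
  rw [intervalIntegral.integral_sub hi (by simp)]
  simp [mul_comm]

theorem lieDeriv_eq_of_orbitIntegral (hX : IsVectorFieldOf φ X) (hf : Continuous f) {g : M → ℝ}
    (hg : ContMDiff (𝓡 n) 𝓘(ℝ, ℝ) ∞ g)
    (h : ∀ t x, g (φ t x) = g x + orbitIntegral φ f t x) (x : M) : lieDeriv X g x = f x := by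
  have h1 := hX.hasDerivAt_lieDeriv hg x 0
  have h2 := (hasDerivAt_orbitIntegral (φ := φ) hf 0 x).const_add (g x)
  simp only [h, φ.map_zero_apply] at h1 h2
  exact h1.unique h2

theorem isInvariant_closure {Z : Set M} (hZ : IsInvariant φ Z) : IsInvariant φ (closure Z) :=
  fun t => (hZ t).closure (φ.continuous_toFun t)

variable [IsManifold (𝓡 n) ∞ M]

/-- If all points have the period `T` and the integral of `f` over a period vanishes, then `f` is a
coboundary. -/
theorem exists_coboundary_of_period (hφ : IsSmoothFlow n φ)
    (hf : ContMDiff (𝓡 n) 𝓘(ℝ, ℝ) ∞ f) {T : ℝ} (hT : T ≠ 0) (hper : ∀ x, φ T x = x)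
    (h0 : ∀ x, orbitIntegral φ f T x = 0) :
    ∃ g : M → ℝ, ContMDiff (𝓡 n) 𝓘(ℝ, ℝ) ∞ g ∧
      ∀ t x, g (φ t x) = g x + orbitIntegral φ f t x := by
  have hfc := hf.continuous
  -- Minus the mean of the cocycle over a period. Moving `x` to `φ t x` shifts the periodic
  -- integrand, which leaves its mean unchanged, and subtracts the constant `orbitIntegral φ f t x`.
  refine ⟨fun x => -∫ u in (0 : ℝ)..1, orbitIntegral φ f (u * T) x, ?_, fun t x => ?_⟩
  · refine (contMDiff_integral_unitInterval
      (F := fun q : M × ℝ => orbitIntegral φ f (q.2 * T) q.1) ?_).neg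
    exact (contMDiff_orbitIntegral hφ hf).comp
      ((contMDiff_snd.mul contMDiff_const).prodMk contMDiff_fst)
  · have hperiodic : Function.Periodic (fun u => orbitIntegral φ f (u * T) x) 1 := fun u => by
      simp only [add_mul, one_mul]
      rw [orbitIntegral_add hfc, h0, zero_add, hper]
    have hcont : Continuous fun u => orbitIntegral φ f (u * T) x :=
      (continuous_orbitIntegral hfc x).comp (by fun_prop)
    have h1 : ∀ u, orbitIntegral φ f (u * T) (φ t x) =
        orbitIntegral φ f ((u + t / T) * T) x - orbitIntegral φ f t x := fun u => by
      rw [add_mul, div_mul_cancel₀ _ hT, orbitIntegral_add hfc]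
      ring
    have h2 : ∫ u in (0 : ℝ)..1, orbitIntegral φ f ((u + t / T) * T) x =
        ∫ u in (0 : ℝ)..1, orbitIntegral φ f (u * T) x := by
      rw [intervalIntegral.integral_comp_add_right (fun u => orbitIntegral φ f (u * T) x)]
      have := hperiodic.intervalIntegral_add_eq (t / T) 0
      rw [zero_add] at this
      rw [← this, zero_add, add_comm]
    simp only [h1]
    rw [intervalIntegral.integral_sub, h2]
    · rw [intervalIntegral.integral_const, sub_zero, one_smul]
      ring
    · exact (hcont.comp (continuous_add_const (t / T))).intervalIntegrable _ _
    · simp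

variable [T2Space M]

/-- A periodic orbit is closed and invariant, hence all of `M`. Every point has period `T` and the
same integral over it, so subtracting the mean `c` leaves a coboundary. -/
theorem cohomologous_of_minimal_of_periodic (hφ : IsSmoothFlow n φ) (hX : IsVectorFieldOf φ X)
    (hmin : IsMinimalSet φ (univ : Set M)) {x₀ : M} {T : ℝ} (hT : 0 < T) (hx₀ : φ T x₀ = x₀)
    (hf : ContMDiff (𝓡 n) 𝓘(ℝ, ℝ) ∞ f) :
    ∃ (g : M → ℝ) (c : ℝ), ContMDiff (𝓡 n) 𝓘(ℝ, ℝ) ∞ g ∧ ∀ x, f x = lieDeriv X g x + c := by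
  have hfc := hf.continuous
  have hperiodic : Function.Periodic (fun t => φ t x₀) T := fun t => by
    change φ (t + T) x₀ = φ t x₀
    rw [φ.map_add, hx₀]
  have horb : φ.orbit x₀ = univ := by
    refine hmin.eq_of_subset _ (subset_univ _) (φ.nonempty_orbit x₀) ?_ (φ.isInvariant_orbit x₀)
    rw [Flow.orbit_eq_range, ← hperiodic.image_Icc hT 0]
    exact (isCompact_Icc.image (φ.continuous continuous_id continuous_const)).isClosed
  have hall : ∀ y, ∃ t, φ t x₀ = y := fun y =>
    φ.mem_orbit_iff.1 (by rw [horb]; exact mem_univ y)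
  have hper : ∀ y, φ T y = y := fun y => by
    obtain ⟨t, rfl⟩ := hall y
    rw [flow_comm, hx₀]
  set c := orbitIntegral φ f T x₀ / T with hc
  have hS : ∀ y, orbitIntegral φ f T y = c * T := fun y => by
    obtain ⟨t, rfl⟩ := hall y
    have h1 := orbitIntegral_add (φ := φ) hfc T t x₀
    rw [add_comm, orbitIntegral_add hfc, hx₀] at h1
    rw [hc, div_mul_cancel₀ _ hT.ne']
    linarith
  have hf' : ContMDiff (𝓡 n) 𝓘(ℝ, ℝ) ∞ (fun y => f y - c) := hf.sub contMDiff_const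
  obtain ⟨g, hg, hgφ⟩ := exists_coboundary_of_period hφ hf' hT.ne' hper
    (fun x => by rw [orbitIntegral_sub_const hfc, hS, sub_self])
  refine ⟨g, c, hg, fun x => ?_⟩
  rw [lieDeriv_eq_of_orbitIntegral hX hf'.continuous hg hgφ]
  ring

variable [CompactSpace M]

/-- Baire bounds `v` on an open `U`. By minimality the orbit of `x₀` enters `U`, and the
displacement equation carries the bound back to a neighbourhood of `x₀`. Any limit `r` of `v` at
`x₀` satisfies `ψ r x₀ = F x₀`, so aperiodicity forces `r = v x₀`. -/
theorem IsTimeChangeConj.continuous_displacement (H : IsTimeChangeConj φ ψ f F c)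
    (hf : Continuous f) (hmin : IsMinimalSet φ (univ : Set M))
    (hap : ∀ x s, ψ s x = x → s = 0) {v : M → ℝ} (hv : ∀ x, ψ (v x) x = F x) : Continuous v := by
  obtain ⟨U, hU, ⟨z, hzU, -⟩, k, hk⟩ := H.exists_isOpen_bounded isClosed_univ hmin.nonempty
  have hvU : ∀ x ∈ U, v x ∈ Icc (-k) k := fun x hx => by
    obtain ⟨w, hw, hwx⟩ := hk x ⟨hx, mem_univ x⟩
    have : v x = w :=
      sub_eq_zero.1 (hap x _ (flow_sub_eq_self ((hv x).trans hwx.symm)))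
    rwa [this]
  refine continuous_iff_continuousAt.2 fun x₀ => ?_
  have hdense : closure (φ.orbit x₀) = univ :=
    hmin.eq_of_subset _ (subset_univ _) (φ.nonempty_orbit x₀).closure isClosed_closure
      (isInvariant_closure (φ.isInvariant_orbit x₀))
  obtain ⟨_, hq, t, rfl⟩ := mem_closure_iff.1 (hdense ▸ mem_univ z) U hU hzU
  replace hq : φ t x₀ ∈ U := hq
  obtain ⟨B, hB⟩ := isCompact_univ.exists_bound_of_continuousOn
    ((continuous_orbitIntegral_right (φ := φ) hf t).continuousOn (s := univ))
  have hbdd : ∀ᶠ x in 𝓝 x₀, v x ∈ Icc (-k - B - c * t) (k + B - c * t) := by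
    filter_upwards [(φ.continuous_toFun t).continuousAt.preimage_mem_nhds (hU.mem_nhds hq)]
      with x hx
    have h1 := H.displacement_eq (hap x) (hv x) (hv (φ t x))
    have h2 := hvU _ hx
    have h3 := abs_le.1 (hB x (mem_univ x))
    constructor <;> linarith [h2.1, h2.2, h3.1, h3.2]
  refine tendsto_iff_ultrafilter _ _ _ |>.2 fun 𝒰 h𝒰 => ?_
  obtain ⟨r, -, hr⟩ := (isCompact_Icc (a := -k - B - c * t)
    (b := k + B - c * t)).ultrafilter_le_nhds (𝒰.map v) (le_principal_iff.2 (h𝒰 hbdd))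
  have hr' : Tendsto v 𝒰 (𝓝 r) := hr
  have h1 : Tendsto (fun x => ψ (v x) x) 𝒰 (𝓝 (ψ r x₀)) :=
    ((ψ.continuous continuous_fst continuous_snd).tendsto (r, x₀)).comp (hr'.prodMk_nhds h𝒰)
  have h2 : Tendsto (fun x => ψ (v x) x) 𝒰 (𝓝 (F x₀)) := by
    simp only [hv]
    exact (F.continuous.tendsto x₀).mono_left h𝒰
  have h3 : ψ r x₀ = ψ (v x₀) x₀ := (tendsto_nhds_unique h1 h2).trans (hv x₀).symm
  have h4 : r = v x₀ := sub_eq_zero.1 (hap x₀ _ (flow_sub_eq_self h3))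
  rwa [← h4]

/-- In a chart at `F x₀`, projecting `ψ (v x) x = F x` to the velocity `w` of `ψ` gives a scalar
equation for `v` with time derivative `⟨w, w⟩ ≠ 0`; the implicit function theorem applies. -/
theorem contMDiff_displacement (hψ : IsSmoothFlow n ψ) (hfree : IsLocallyFree ψ) {F : M → M}
    (hF : ContMDiff (𝓡 n) (𝓡 n) ∞ F) {v : M → ℝ} (hvc : Continuous v)
    (hv : ∀ x, ψ (v x) x = F x) : ContMDiff (𝓡 n) 𝓘(ℝ, ℝ) ∞ v := by
  intro x₀
  obtain ⟨Y, hY⟩ := hψ.exists_isVectorFieldOf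
  have hY0 : ∀ x, Y x ≠ 0 := fun x h0 => by
    obtain ⟨ε, hε, h⟩ := hfree x
    exact h (ε / 2) (by positivity) (by rw [abs_of_pos (by positivity)]; linarith)
      (flow_eq_self_of_vectorField_eq_zero hψ hY h0 _)
  set e := extChartAt (𝓡 n) (F x₀) with he
  have hmd := mdifferentiableAt_extChartAt (I := 𝓡 n) (x := F x₀) (y := F x₀)
    (mem_chart_source _ _)
  let w : EuclideanSpace ℝ (Fin n) :=
    mfderiv (𝓡 n) 𝓘(ℝ, EuclideanSpace ℝ (Fin n)) e (F x₀) (Y (F x₀))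
  have hw : w ≠ 0 := mfderiv_extChartAt_ne_zero (mem_extChartAt_source _) (hY0 _)
  have hder : HasDerivAt (fun t => e (ψ t x₀)) w (v x₀) := by
    have h1 : HasDerivAt (fun t => e (ψ t (F x₀))) w (v x₀ - v x₀) := by
      rw [sub_self]
      exact hY.hasDerivAt_comp hmd
    refine (h1.comp_sub_const (v x₀) (v x₀)).congr_of_eventuallyEq
      (Eventually.of_forall fun t => ?_)
    simp only [← hv x₀, ← ψ.map_add, sub_add_cancel]
  have hlin : ContDiff ℝ ∞ fun y : EuclideanSpace ℝ (Fin n) => inner ℝ w y :=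
    contDiff_const.inner ℝ contDiff_id
  have heF : ContMDiffAt (𝓡 n) 𝓘(ℝ, EuclideanSpace ℝ (Fin n)) ∞ e (F x₀) :=
    contMDiffAt_extChartAt
  refine contMDiffAt_of_implicit (I := 𝓡 n) (Φ := fun q : M × ℝ => inner ℝ w (e (ψ q.2 q.1)))
    (r := fun x => inner ℝ w (e (F x))) (d := inner ℝ w w) ?_ ?_ (inner_self_ne_zero.2 hw)
    hvc.continuousAt ?_ (Eventually.of_forall fun x => by simp only [hv])
  · have h1 : ContMDiff ((𝓡 n).prod 𝓘(ℝ, ℝ)) (𝓡 n) ∞ (fun q : M × ℝ => ψ q.2 q.1) :=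
      ContMDiff.comp (g := fun p : ℝ × M => ψ p.1 p.2) hψ (contMDiff_snd.prodMk contMDiff_fst)
    have h2 : ContMDiffAt ((𝓡 n).prod 𝓘(ℝ, ℝ)) 𝓘(ℝ, EuclideanSpace ℝ (Fin n)) ∞
        (fun q : M × ℝ => e (ψ q.2 q.1)) (x₀, v x₀) :=
      ContMDiffAt.comp (g := e) (f := fun q : M × ℝ => ψ q.2 q.1) _
        (by simpa only [hv] using heF) h1.contMDiffAt
    exact hlin.contMDiff.contMDiffAt.comp _ h2
  · have h1 := (hasDerivAt_const (v x₀) w).inner ℝ hder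
    simpa using h1
  · exact hlin.contMDiff.contMDiffAt.comp _ (heF.comp x₀ hF.contMDiffAt)

theorem IsParameterRigid.cohomologous_of_pos (hrig : IsParameterRigid n φ)
    (hφ : IsSmoothFlow n φ) (hX : IsVectorFieldOf φ X) (hX0 : ∀ x : M, X x ≠ 0) [Nonempty M]
    (hf : ContMDiff (𝓡 n) 𝓘(ℝ, ℝ) ∞ f) (hpos : ∀ x, 0 < f x) :
    ∃ (g : M → ℝ) (c : ℝ), ContMDiff (𝓡 n) 𝓘(ℝ, ℝ) ∞ g ∧ ∀ x, f x = lieDeriv X g x + c := by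
  have hfree := isLocallyFree_of_vectorField_ne_zero hX hX0
  have hmin : IsMinimalSet φ (univ : Set M) := by
    obtain ⟨K, -, hK⟩ := exists_isMinimalSet_subset (φ := φ) univ_nonempty isClosed_univ
      (fun _ _ _ => mem_univ _)
    exact hrig.eq_univ_of_isMinimalSet hφ hfree hK ▸ hK
  by_cases hper : ∃ x T, φ T x = x ∧ T ≠ 0
  · obtain ⟨x, T, hT, hT0⟩ := hper
    exact cohomologous_of_minimal_of_periodic hφ hX hmin (abs_pos.2 hT0) (flow_abs_eq_self hT) hf
  push Not at hper
  have hfc := hf.continuous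
  obtain ⟨ψ, F, c, hψ, hψfree, hF, H⟩ := hrig.exists_isTimeChangeConj hφ hfree hf hpos
  have hap : ∀ x s, ψ s x = x → s = 0 := fun x => H.aperiodic hfc hpos (hper x)
  choose v hv using H.exists_eq
  have hvs := contMDiff_displacement hψ hψfree hF (H.continuous_displacement hfc hmin hap hv) hv
  have hf' : ContMDiff (𝓡 n) 𝓘(ℝ, ℝ) ∞ (fun y => f y - c) := hf.sub contMDiff_const
  -- The displacement equation says that `-v` grows along orbits by the integral of `f - c`.
  refine ⟨fun x => -v x, c, hvs.neg, fun x => ?_⟩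
  rw [lieDeriv_eq_of_orbitIntegral hX hf'.continuous hvs.neg fun t x => ?_]
  · ring
  · have := H.displacement_eq (hap x) (hv x) (hv (φ t x))
    rw [orbitIntegral_sub_const hfc]
    linarith

theorem IsParameterRigid.cohomologous (hrig : IsParameterRigid n φ)
    (hφ : IsSmoothFlow n φ) (hX : IsVectorFieldOf φ X) (hX0 : ∀ x : M, X x ≠ 0)
    (hf : ContMDiff (𝓡 n) 𝓘(ℝ, ℝ) ∞ f) :
    ∃ (g : M → ℝ) (c : ℝ), ContMDiff (𝓡 n) 𝓘(ℝ, ℝ) ∞ g ∧ ∀ x, f x = lieDeriv X g x + c := by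
  rcases isEmpty_or_nonempty M with hM | hM
  · exact ⟨f, 0, hf, fun x => hM.elim x⟩
  obtain ⟨B, hB⟩ := isCompact_univ.exists_bound_of_continuousOn
    (hf.continuous.continuousOn (s := univ))
  -- With `|f| ≤ B`, adding `B + 1` makes `f` positive; the constant is absorbed into `c`.
  obtain ⟨g, c, hg, hgc⟩ := hrig.cohomologous_of_pos (f := fun x => f x + (B + 1)) hφ hX hX0
    (hf.add contMDiff_const) (fun x => by linarith [(abs_le.1 (hB x (mem_univ x))).1])
  exact ⟨g, c - (B + 1), hg, fun x => by linarith [hgc x]⟩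

end Necessity

end ParamRigid

theorem mainTheorem5 {n : ℕ} {M : Type*} [TopologicalSpace M]
    [ChartedSpace (EuclideanSpace ℝ (Fin n)) M] [IsManifold (𝓡 n) ∞ M]
    [T2Space M] [CompactSpace M]
    (φ : Flow ℝ M) (hφ : ParamRigid.IsSmoothFlow n φ)
    (X : (x : M) → TangentSpace (𝓡 n) x) (hX : ParamRigid.IsVectorFieldOf φ X)
    (hX0 : ∀ x : M, X x ≠ 0) :
    ParamRigid.IsParameterRigid n φ ↔
      ∀ f : M → ℝ, ContMDiff (𝓡 n) 𝓘(ℝ, ℝ) ∞ f →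
        ∃ (g : M → ℝ) (c : ℝ), ContMDiff (𝓡 n) 𝓘(ℝ, ℝ) ∞ g ∧
          ∀ x : M, f x = ParamRigid.lieDeriv X g x + c :=
  ⟨fun hrig _ hf => hrig.cohomologous hφ hX hX0 hf,
    ParamRigid.isParameterRigid_of_cohomologous hφ hX hX0⟩
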